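/- Let $n\ge 2$, let $\mathbb K$ be a field, and let $r^{1/2},s^{1/2}\in\mathbb K$ be nonzero with squares $r,s$ (for instance $\mathbb K=\mathbb Q(r^{1/2},s^{1/2})$ or any extension field of it, such as the one obtained by adjoining indeterminates $z,w$). Powers $r^{k/2},s^{k/2}$ mean powers of these elements. Let $V=\mathbb K^{2n}$, let $E_{ij}$ $(1\le i,j\le 2n)$ be the matrix units, $i'=2n+1-i$, $P=\sum_{i,j}E_{ij}\otimes E_{ji}$, and $\rho_i=n-i$ for $1\le i\le n$, $\rho_{n+1}=0$, $\rho_i=n-i+1$ for $n+2\le i\le 2n$. Given operators $f(i,j)$ write $$\mathcal S[f(i,j)]=\sum_{\substack{1\le i\le n-1\\ i+1\le j\le n}}f(i,j)+\sum_{\substack{1\le i\le n-1\\ i'+1\le j\le 2n}}f(i,j)+\sum_{j=n+2}^{2n}f(n,j)+\sum_{\substack{n+1\le i\le 2n-1\\ i+1\le j\le 2n}}f(j,i)+\sum_{\substack{1\le i\le n-1\\ n+1\le j\le 2n-i}}f(j,i).$$ The basic (braiding) $R$-matrix of $U_{r,s}(\mathfrak{so}_{2n})$ on $V\otimes V$ is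 $$\begin{aligned}R={}&r^{-\frac12}s^{\frac12}\sum_iE_{ii}\otimes E_{ii}+r^{\frac12}s^{-\frac12}\sum_iE_{ii'}\otimes E_{i'i}+r^{-\frac12}s^{-\frac12}\,\mathcal S[E_{ij}\otimes E_{ji}]+r^{\frac12}s^{\frac12}\,\mathcal S[E_{ji}\otimes E_{ij}]\\&+(r^{-\frac12}s^{\frac12}-r^{\frac12}s^{-\frac12})\Bigl\{\sum_{i<j}E_{jj}\otimes E_{ii}-\sum_{i>j}(r^{-\frac12}s^{\frac12})^{\rho_i-\rho_j}E_{ij'}\otimes E_{i'j}\Bigr\}.\end{aligned}$$ For $z\in\mathbb K$ with $rz\ne s$ and $z\neq r^{1-n}s^{n-1}$ (that is, $z$ is not a pole) put $$\begin{aligned}R(z)={}&\sum_iE_{ii}\otimes E_{ii}+\frac{rs(z-1)}{rz-s}\,\mathcal S[E_{ij}\otimes E_{ji}]+\frac{z-1}{rz-s}\,\mathcal S[E_{ji}\otimes E_{ij}]\\&+\frac{r-s}{rz-s}\Bigl\{z\sum_{i<j,\ i'\ne j}E_{jj}\otimes E_{ii}+\sum_{i>j,\ i'\neq j}E_{jj}\otimes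 E_{ii}\Bigr\}+\sum_{i,j=1}^{2n}c_{ij}(z)\,E_{ij'}\otimes E_{i'j},\end{aligned}$$ where $c_{ij}(z)=\dfrac{d_{ij}(z)}{(z-r^{1-n}s^{n-1})(rz-s)}$ and $$d_{ij}(z)=\begin{cases}(s-r)z\bigl\{(r^{-\frac12}s^{\frac12})^{\rho_j-\rho_i}(z-1)-\delta_{ij'}[z-(rs^{-1})^{1-n}]\bigr\},& i>j,\\ (s-r)\bigl\{(r^{-\frac12}s^{\frac12})^{\rho_j-\rho_i+2n-2}(z-1)-\delta_{ij'}[z-(rs^{-1})^{1-n}]\bigr\},& i<j,\\ s\,[z-(rs^{-1})^{2-n}](z-1),& i=j.\end{cases}$$ Put $\hat R(z)=P\,R(z)$. For an operator $A$ on $V\otimes V$ let $A_{12},A_{13},A_{23}$ be its copies acting on the indicated factors of $V^{\otimes3}$, and $A_{21}=PAP$. Let $\lambda_1=r^{-\frac12}s^{\frac12}$, $\lambda_2=-r^{\frac12}s^{-\frac12}$, $\lambda_3=r^{\frac{2n-1}2}s^{-\frac{2n-1}2}$. Then: 1. $R$ is invertible, $(R-\lambda_1)(R-\lambda_2)(R-\lambda_3)=0$,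 and $R_{12}R_{23}R_{12}=R_{23}R_{12}R_{23}$. 2. $R(z)$ is a Yang–Baxterization of $R$: if $z$ is not a pole, $$R(z)=\frac{r}{(z-r^{1-n}s^{n-1})(rz-s)}\Bigl\{\lambda_1z(z-1)R_{21}^{-1}+\Bigl(1+\frac{\lambda_1}{\lambda_2}+\frac{\lambda_1}{\lambda_3}+\frac{\lambda_2}{\lambda_3}\Bigr)z\cdot 1-\lambda_3^{-1}(z-1)R_{21}\Bigr\};$$ in particular $R(0)=r^{\frac12}s^{-\frac12}R_{21}$. 3. Explicitly, if $z$ is not a pole, $$\begin{aligned}\hat R(z)={}&\sum_iE_{ii}\otimes E_{ii}+\frac{rs(z-1)}{rz-s}\,\mathcal S[E_{jj}\otimes E_{ii}]+\frac{z-1}{rz-s}\,\mathcal S[E_{ii}\otimes E_{jj}]\\&+\frac{r-s}{rz-s}\Bigl\{z\sum_{i<j,\ i'\neq j}E_{ij}\otimes E_{ji}+\sum_{i>j,\ i'\ne j}E_{ij}\otimes E_{ji}\Bigr\}+\sum_{i,j=1}^{2n}c_{ij}(z)\,E_{i'j'}\otimes E_{ij}.\end{aligned}$$ 4. If none of $z,w,zw$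 is a pole, then $\hat R_{12}(z)\hat R_{13}(zw)\hat R_{23}(w)=\hat R_{23}(w)\hat R_{13}(zw)\hat R_{12}(z)$. 5. If $z\ne0$ and neither $z$ nor $z^{-1}$ is a pole, then $\hat R_{21}(z)\hat R(z^{-1})=\hat R(z^{-1})\hat R_{21}(z)=1$. -/

import Mathlib

open scoped Matrix Kronecker

/-! Throughout `K` is a field, `a` and `b` are elements of `K` standing for `r^{1/2}` and `s^{1/2}`
(so `r = a ^ 2`, `s = b ^ 2`), and the basis vectors `v_1, …, v_{2n}` of `V = K^{2n}` are indexed by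
`Fin (2 * n)`. -/

namespace TwoParamD

variable {K : Type*} [Field K]

/-- Operators on `V ⊗ V`, as matrices in the basis `v_i ⊗ v_j`. -/
abbrev Op2 (K : Type*) (n : ℕ) : Type _ :=
  Matrix (Fin (2 * n) × Fin (2 * n)) (Fin (2 * n) × Fin (2 * n)) K

/-- Operators on `V ⊗ V ⊗ V`, as matrices in the basis `v_i ⊗ v_j ⊗ v_k`. -/
abbrev Op3 (K : Type*) (n : ℕ) : Type _ :=
  Matrix (Fin (2 * n) × Fin (2 * n) × Fin (2 * n)) (Fin (2 * n) × Fin (2 * n) × Fin (2 * n)) K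

/-- The one-based number `1, …, 2n` of an index. -/
def pos {n : ℕ} (i : Fin (2 * n)) : ℕ := (i : ℕ) + 1

/-- The index `i' = 2n + 1 - i`. -/
abbrev op {n : ℕ} (i : Fin (2 * n)) : Fin (2 * n) := Fin.rev i

/-- `E_{ij} ⊗ E_{kl}`. -/
def EE (K : Type*) [Field K] {n : ℕ} (i j k l : Fin (2 * n)) : Op2 K n :=
  Matrix.single i j (1 : K) ⊗ₖ Matrix.single k l (1 : K)

/-- The sum of `f i j` over all pairs of indices whose one-based numbers satisfy `c`. -/
def sumOver {n : ℕ} (c : ℕ → ℕ → Prop) [∀ i j, Decidable (c i j)]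
    (f : Fin (2 * n) → Fin (2 * n) → Op2 K n) : Op2 K n :=
  ∑ i, ∑ j, if c (pos i) (pos j) then f i j else 0

/-- The sum of the five double sums that occur in the braces of all the formulas below:
`f i j` is summed over `1 ≤ i ≤ n-1, i+1 ≤ j ≤ n`; over `1 ≤ i ≤ n-1, i'+1 ≤ j ≤ 2n`; and over
`i = n, n+2 ≤ j ≤ 2n`; and `f j i` is summed over `n+1 ≤ i ≤ 2n-1, i+1 ≤ j ≤ 2n`, and over
`1 ≤ i ≤ n-1, n+1 ≤ j ≤ 2n-i`. -/
def braceSum {n : ℕ} (f : Fin (2 * n) → Fin (2 * n) → Op2 K n) : Op2 K n :=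
  sumOver (fun i j => (1 ≤ i ∧ i ≤ n - 1) ∧ (i + 1 ≤ j ∧ j ≤ n)) f
  + sumOver (fun i j => (1 ≤ i ∧ i ≤ n - 1) ∧ ((2 * n + 1 - i) + 1 ≤ j ∧ j ≤ 2 * n)) f
  + sumOver (fun i j => i = n ∧ (n + 2 ≤ j ∧ j ≤ 2 * n)) f
  + sumOver (fun i j => (n + 1 ≤ i ∧ i ≤ 2 * n - 1) ∧ (i + 1 ≤ j ∧ j ≤ 2 * n)) (fun i j => f j i)
  + sumOver (fun i j => (1 ≤ i ∧ i ≤ n - 1) ∧ (n + 1 ≤ j ∧ j ≤ 2 * n - i)) (fun i j => f j i)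

/-- `ρ_i = n - i` for `1 ≤ i ≤ n`, `ρ_{n+1} = 0`, and `ρ_i = n - i + 1` for `n + 2 ≤ i ≤ 2n`. -/
def rho {n : ℕ} (i : Fin (2 * n)) : ℤ :=
  if pos i ≤ n then (n : ℤ) - pos i
  else if pos i = n + 1 then 0
  else (n : ℤ) - pos i + 1

/-- The flip `P = ∑ E_{ij} ⊗ E_{ji}`. -/
def flip (K : Type*) [Field K] (n : ℕ) : Op2 K n := ∑ i, ∑ j, EE K i j j i

/-- The basic (braiding) `R`-matrix of `U_{r,s}(so_{2n})` on `V ⊗ V`. -/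
def basicR (n : ℕ) (a b : K) : Op2 K n :=
  (a⁻¹ * b) • ∑ i, EE K i i i i
  + (a * b⁻¹) • ∑ i, EE K i (op i) (op i) i
  + (a⁻¹ * b⁻¹) • braceSum (fun i j => EE K i j j i)
  + (a * b) • braceSum (fun i j => EE K j i i j)
  + (a⁻¹ * b - a * b⁻¹) •
      ((∑ i, ∑ j, if i < j then EE K j j i i else 0)
        - ∑ i, ∑ j, if i > j then
            ((a⁻¹ * b) ^ (rho i - rho j)) • EE K i (op j) (op i) j else 0)

/-- The coefficients `d_{ij}(z)`. -/
def dCoeff (n : ℕ) (a b z : K) (i j : Fin (2 * n)) : K :=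
  let r := a ^ 2
  let s := b ^ 2
  let δ : K := if i = op j then 1 else 0
  if i > j then
    (s - r) * z * ((a⁻¹ * b) ^ (rho j - rho i) * (z - 1) - δ * (z - (r * s⁻¹) ^ (1 - (n : ℤ))))
  else if i < j then
    (s - r) * ((a⁻¹ * b) ^ (rho j - rho i + 2 * (n : ℤ) - 2) * (z - 1)
      - δ * (z - (r * s⁻¹) ^ (1 - (n : ℤ))))
  else
    s * (z - (r * s⁻¹) ^ (2 - (n : ℤ))) * (z - 1)

/-- The spectral parameter dependent `R`-matrix `R(z)`. -/
def spectralR (n : ℕ) (a b z : K) : Op2 K n :=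
  let r := a ^ 2
  let s := b ^ 2
  (∑ i, EE K i i i i)
  + (r * s * (z - 1) / (r * z - s)) • braceSum (fun i j => EE K i j j i)
  + ((z - 1) / (r * z - s)) • braceSum (fun i j => EE K j i i j)
  + ((r - s) / (r * z - s)) •
      (z • (∑ i, ∑ j, if i < j ∧ op i ≠ j then EE K j j i i else 0)
        + ∑ i, ∑ j, if i > j ∧ i ≠ op j then EE K j j i i else 0)
  + (1 / ((z - r ^ (1 - (n : ℤ)) * s ^ ((n : ℤ) - 1)) * (r * z - s))) •
      ∑ i, ∑ j, dCoeff n a b z i j • EE K i (op j) (op i) j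

/-- The coefficients `c_{ij}(z)`. -/
def cCoeff (n : ℕ) (a b z : K) (i j : Fin (2 * n)) : K :=
  dCoeff n a b z i j /
    ((z - (a ^ 2) ^ (1 - (n : ℤ)) * (b ^ 2) ^ ((n : ℤ) - 1)) * (a ^ 2 * z - b ^ 2))

/-- `R̂(z) = P ∘ R(z)`. -/
def spectralRHat (n : ℕ) (a b z : K) : Op2 K n := flip K n * spectralR n a b z

/-- The explicit expression for `R̂(z)`. -/
def explicitRHat (n : ℕ) (a b z : K) : Op2 K n :=
  let r := a ^ 2
  let s := b ^ 2
  (∑ i, EE K i i i i)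
  + (r * s * (z - 1) / (r * z - s)) • braceSum (fun i j => EE K j j i i)
  + ((z - 1) / (r * z - s)) • braceSum (fun i j => EE K i i j j)
  + ((r - s) / (r * z - s)) •
      (z • (∑ i, ∑ j, if i < j ∧ op i ≠ j then EE K i j j i else 0)
        + ∑ i, ∑ j, if i > j ∧ i ≠ op j then EE K i j j i else 0)
  + ∑ i, ∑ j, cCoeff n a b z i j • EE K (op i) (op j) i j

/-- `z` is not a pole of `R(z)`. -/
def NotPole (n : ℕ) (a b z : K) : Prop :=
  a ^ 2 * z - b ^ 2 ≠ 0 ∧ z - (a ^ 2) ^ (1 - (n : ℤ)) * (b ^ 2) ^ ((n : ℤ) - 1) ≠ 0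

/-- `A_{12} = A ⊗ 1`. -/
def leg12 {n : ℕ} (A : Op2 K n) : Op3 K n :=
  Matrix.of fun x y => if x.2.2 = y.2.2 then A (x.1, x.2.1) (y.1, y.2.1) else 0

/-- `A_{13}`: the operator `A` on the first and third tensor factors. -/
def leg13 {n : ℕ} (A : Op2 K n) : Op3 K n :=
  Matrix.of fun x y => if x.2.1 = y.2.1 then A (x.1, x.2.2) (y.1, y.2.2) else 0

/-- `A_{23} = 1 ⊗ A`. -/
def leg23 {n : ℕ} (A : Op2 K n) : Op3 K n :=
  Matrix.of fun x y => if x.1 = y.1 then A (x.2.1, x.2.2) (y.2.1, y.2.2) else 0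

/-- `A_{21} = P A P`. -/
def leg21 {n : ℕ} (A : Op2 K n) : Op2 K n := flip K n * A * flip K n

/-- The (unnormalized) Yang-Baxterization, in the sense of Ge, Wu and Xue, of an invertible braid
matrix `S` with the three eigenvalues `l1, l2, l3`. -/
noncomputable def yangBaxterize {n : ℕ} (S : Op2 K n) (l1 l2 l3 z : K) : Op2 K n :=
  (l1 * z * (z - 1)) • S⁻¹
  + ((1 + l1 / l2 + l1 / l3 + l2 / l3) * z) • (1 : Op2 K n)
  - (l3⁻¹ * (z - 1)) • S

end TwoParamD

/-! The matrices `basicR` and `spectralR` are handled without any expansion of triple products.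
Put `q = a⁻¹ b`, so that `r` and `s` enter only through `q` and through the product `a b`.

Conjugation by a diagonal matrix `twistWeight (a b)` turns `basicR` into the one-parameter braid
matrix `stdR n q` of type `D_n` (`basicR_eq_twist`), and on `V ⊗ V ⊗ V` one diagonal matrix `twist3`
serves both `R₁₂` and `R₂₃`, because the twist is a bicharacter in the weights of `V` and all
operators concerned preserve weights (`PreservesWeight.leg12_twist2`). So the relations needed may
be proved for `stdR`.

Let `cupCap` be the rank-one operator onto the invariant vector of `V ⊗ V`. Both `stdR` and `cupCap`
commute with the coproducts of the Chevalley generators of the quantum orthogonal algebra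
(`stdR_mem`, `cupCap_mem`). An operator on `V ⊗ V ⊗ V` that commutes with them vanishes as soon as
it vanishes on the vectors `v_1 ⊗ v_j ⊗ v_{2n}`, which generate the whole space
(`eq_zero_of_mem_invariants3`). On these vectors `stdR` acts almost as a flip, which makes the
relations of the Birman–Murakami–Wenzl algebra immediate (`stdR_bmw`): the braid relation is one of
them, and invertibility and the cubic equation follow from the others.

An abstract computation in that algebra shows that its generators admit a Yang–Baxterization
(`BMWRelations.yang_baxter`) which is unitary up to a scalar (`baxter_mul_baxter_inv`). A comparison
of entries identifies `R(z)` with a multiple of this Yang–Baxterization for `R_{21}`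
(`spectralR_eq_baxter`), and moving the flips through the three tensor factors changes the braided
Yang–Baxter equation into the quantum one (`quantum_yang_baxter_of_braided`). -/

namespace TwoParamD

/-! ### Indices, basis vectors and the one-parameter braid matrix -/

section

section Index
variable {n : ℕ}

lemma op_op (i : Fin (2 * n)) : op (op i) = i := Fin.rev_rev i

lemma op_ne_self (i : Fin (2 * n)) : op i ≠ i := by
  intro h
  have := congrArg Fin.val h
  rw [Fin.val_rev] at this
  omega

lemma eq_op_comm {i j : Fin (2 * n)} : i = op j ↔ j = op i :=
  ⟨fun h => by rw [h, op_op], fun h => by rw [h, op_op]⟩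

lemma rho_op (i : Fin (2 * n)) : rho (op i) = -rho i := by
  have := i.isLt
  simp only [rho, pos, Fin.val_rev]
  split_ifs <;> omega

/-- The function `ρ` separates all indices except `n` and `n + 1 = n'`. -/
lemma eq_or_eq_op_of_rho_eq {i j : Fin (2 * n)} (h : rho i = rho j) : i = j ∨ i = op j := by
  have := i.isLt
  have := j.isLt
  simp only [rho, pos] at h
  rw [Fin.ext_iff, Fin.ext_iff, Fin.val_rev]
  split_ifs at h <;> omega

lemma lt_iff_rho_lt {i j : Fin (2 * n)} (h : j ≠ op i) : i < j ↔ rho j < rho i := by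
  have := i.isLt
  have := j.isLt
  rw [Ne, Fin.ext_iff, Fin.val_rev] at h
  simp only [rho, pos]
  rw [Fin.lt_def]
  split_ifs <;> omega

end Index

/-- The one-parameter braid matrix of type `D_n`, obtained from `basicR` by removing the factors
`(r s)^{±1/2}`. All order relations between indices are expressed through `ρ`, which makes the
symmetry exchanging `n` and `n + 1` visible. -/
def stdR (n : ℕ) {K : Type*} [Field K] (q : K) : Op2 K n := Matrix.of fun x y =>
  (if x.1 = y.2 ∧ x.2 = y.1 then
      (if y.1 = y.2 then q else if y.2 = op y.1 then q⁻¹ else 1) else 0)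
  + (if x = y ∧ rho y.1 < rho y.2 then q - q⁻¹ else 0)
  - (if (x.2 = op x.1 ∧ y.2 = op y.1) ∧ rho x.1 < rho y.2 then
      (q - q⁻¹) * q ^ (rho x.1 + rho y.1) else 0)

/-- The rank-one operator `v_k ⊗ v_l ↦ δ_{l k'} q^{ρ_k} ∑ q^{ρ_i} v_i ⊗ v_{i'}`. -/
def cupCap (n : ℕ) {K : Type*} [Field K] (q : K) : Op2 K n := Matrix.of fun x y =>
  if x.2 = op x.1 ∧ y.2 = op y.1 then q ^ (rho x.1 + rho y.1) else 0

variable {K : Type*} [Field K] {n : ℕ}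

/-- The basis vector `v_k ⊗ v_l`. -/
def ket (K : Type*) [Field K] (k l : Fin (2 * n)) : Fin (2 * n) × Fin (2 * n) → K :=
  Pi.single (k, l) 1

/-- The basis vector `v_k ⊗ v_l ⊗ v_m`. -/
def ket3 (K : Type*) [Field K] (k l m : Fin (2 * n)) :
    Fin (2 * n) × Fin (2 * n) × Fin (2 * n) → K :=
  Pi.single (k, l, m) 1

lemma ket_apply (k l : Fin (2 * n)) (x : Fin (2 * n) × Fin (2 * n)) :
    ket K k l x = if x.1 = k ∧ x.2 = l then 1 else 0 := by
  simp [ket, Pi.single_apply, Prod.ext_iff]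

/-- The partial sum `∑_{ρ_i < ρ_l} q^{ρ_i} v_i ⊗ v_{i'}` of the invariant vector. -/
def halfCup (q : K) (l : Fin (2 * n)) : Fin (2 * n) × Fin (2 * n) → K :=
  ∑ i, if rho i < rho l then q ^ rho i • ket K i (op i) else 0

lemma halfCup_apply (q : K) (l : Fin (2 * n)) (x : Fin (2 * n) × Fin (2 * n)) :
    halfCup q l x = if x.2 = op x.1 ∧ rho x.1 < rho l then q ^ rho x.1 else 0 := by
  rw [halfCup, Finset.sum_apply, Finset.sum_eq_single x.1]
  · by_cases h1 : rho x.1 < rho l <;> by_cases h2 : x.2 = op x.1 <;> simp [h1, h2, ket_apply]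
  · intro i _ hi
    split_ifs <;> simp [ket_apply, Ne.symm hi]
  · simp

/-- The invariant vector `∑ q^{ρ_i} v_i ⊗ v_{i'}`. -/
def cup (n : ℕ) (q : K) : Fin (2 * n) × Fin (2 * n) → K :=
  ∑ i, q ^ rho i • ket K i (op i)

lemma cup_apply (q : K) (x : Fin (2 * n) × Fin (2 * n)) :
    cup n q x = if x.2 = op x.1 then q ^ rho x.1 else 0 := by
  rw [cup, Finset.sum_apply, Finset.sum_eq_single x.1]
  · by_cases h2 : x.2 = op x.1 <;> simp [h2, ket_apply]
  · intro i _ hi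
    simp [ket_apply, Ne.symm hi]
  · simp

lemma mulVec_ket (A : Op2 K n) (k l : Fin (2 * n)) : A *ᵥ ket K k l = fun x => A x (k, l) := by
  rw [ket, Matrix.mulVec_single_one]; rfl

lemma mulVec_ket3 (A : Op3 K n) (k l m : Fin (2 * n)) :
    A *ᵥ ket3 K k l m = fun x => A x (k, l, m) := by
  rw [ket3, Matrix.mulVec_single_one]; rfl

lemma stdR_mulVec_ket {q : K} (hq : q ≠ 0) (k l : Fin (2 * n)) :
    stdR n q *ᵥ ket K k l =
      (if k = l then q else if l = op k then q⁻¹ else 1) • ket K l k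
      + (if rho k < rho l then q - q⁻¹ else 0) • ket K k l
      - (if l = op k then (q - q⁻¹) * q ^ rho k else 0) • halfCup q l := by
  rw [mulVec_ket]
  ext ⟨x, y⟩
  simp only [stdR, Matrix.of_apply, Pi.add_apply, Pi.sub_apply, Pi.smul_apply, smul_eq_mul,
    ket_apply, halfCup_apply, Prod.mk.injEq]
  congr 1
  · congr 1
    · simp
    · by_cases h1 : rho k < rho l <;> by_cases h2 : x = k <;> by_cases h3 : y = l <;>
        simp [h1, h2, h3]
  · by_cases h1 : l = op k <;> by_cases h2 : y = op x <;> by_cases h3 : rho x < rho l <;>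
      simp [h1, h2, h3, zpow_add₀ hq] <;> ring_nf

lemma cupCap_mulVec_ket {q : K} (hq : q ≠ 0) (k l : Fin (2 * n)) :
    cupCap n q *ᵥ ket K k l = (if l = op k then q ^ rho k else 0) • cup n q := by
  rw [mulVec_ket]
  ext ⟨x, y⟩
  simp only [cupCap, Matrix.of_apply, Pi.smul_apply, smul_eq_mul, cup_apply]
  by_cases h1 : l = op k <;> by_cases h2 : y = op x <;> simp [h1, h2, zpow_add₀ hq]
  ring

lemma stdR_transpose (q : K) : (stdR n q)ᵀ = stdR n q := by
  ext ⟨x, y⟩ ⟨k, l⟩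
  simp only [stdR, Matrix.transpose_apply, Matrix.of_apply, Prod.mk.injEq]
  congr 1
  · congr 1
    · by_cases h1 : x = l <;> by_cases h2 : y = k
      · subst h1 h2
        by_cases h3 : x = y
        · simp [h3]
        · have : y = op x ↔ x = op y := eq_op_comm
          simp [h3, this, Ne.symm h3]
      · simp [h1, h2, Ne.symm h2]
      · simp [h1, h2, Ne.symm h1]
      · simp [h1, h2, Ne.symm h2]
    · by_cases h1 : k = x <;> by_cases h2 : l = y
      · simp [h1, h2]
      · simp [h2, Ne.symm h2]
      · simp [h1, Ne.symm h1]
      · simp [h1, Ne.symm h1]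
  · by_cases h1 : l = op k <;> by_cases h2 : y = op x
    · subst h1 h2
      simp only [rho_op, true_and]
      have : rho k < -rho x ↔ rho x < -rho k := by omega
      simp [this, add_comm]
    all_goals simp [h1, h2]

lemma cupCap_transpose (q : K) : (cupCap n q)ᵀ = cupCap n q := by
  ext x y
  simp only [cupCap, Matrix.transpose_apply, Matrix.of_apply, add_comm, and_comm]

end

/-! ### Operators on `V ⊗ V` commuting with the quantum group -/

section

variable {K : Type*} [Field K] {n : ℕ}

/-- The simple raising operator `v_s ↦ v_p`, `v_{p'} ↦ -v_{s'}` of `so_{2n}`, for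
`ρ_p = ρ_s + 1`. -/
def raiseOp (K : Type*) [Field K] (p s : Fin (2 * n)) : Matrix (Fin (2 * n)) (Fin (2 * n)) K :=
  Matrix.single p s 1 - Matrix.single (op s) (op p) 1

lemma raiseOp_apply (p s x k : Fin (2 * n)) :
    raiseOp K p s x k =
      (if x = p ∧ k = s then 1 else 0) - (if x = op s ∧ k = op p then 1 else 0) := by
  simp only [raiseOp, Matrix.sub_apply, Matrix.single_apply, eq_comm (a := p), eq_comm (a := s),
    eq_comm (a := op s), eq_comm (a := op p)]

/-- The eigenvalues of the group-like element that accompanies `raiseOp K p s`. -/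
def grpLike (q : K) (p s m : Fin (2 * n)) : K :=
  if m = p ∨ m = op s then q else if m = s ∨ m = op p then q⁻¹ else 1

/-- The action on `V ⊗ V` of an element that acts on `V` by `M` and has the coproduct
`M ⊗ ω + 1 ⊗ M`, where `ω` is a diagonal group-like element. -/
def coprod2 (ω : Fin (2 * n) → K) (M : Matrix (Fin (2 * n)) (Fin (2 * n)) K) : Op2 K n :=
  M ⊗ₖ Matrix.diagonal ω + 1 ⊗ₖ M

lemma mulVec_ket_ext {A B : Op2 K n} (h : ∀ k l, A *ᵥ ket K k l = B *ᵥ ket K k l) : A = B :=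
  Matrix.ext_of_mulVec_single fun i => h i.1 i.2

lemma coprod2_mulVec_ket (ω : Fin (2 * n) → K) (p s k l : Fin (2 * n)) :
    coprod2 ω (raiseOp K p s) *ᵥ ket K k l =
      ω l •
        ((if k = s then (1 : K) else 0) • ket K p l
          - (if k = op p then (1 : K) else 0) • ket K (op s) l)
      + ((if l = s then (1 : K) else 0) • ket K k p
          - (if l = op p then (1 : K) else 0) • ket K k (op s)) := by
  have and_mul : ∀ (P Q : Prop) [Decidable P] [Decidable Q],
      (if P ∧ Q then (1 : K) else 0) = (if P then 1 else 0) * (if Q then 1 else 0) := by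
    intro P Q _ _
    by_cases hP : P <;> by_cases hQ : Q <;> simp [hP, hQ]
  rw [mulVec_ket]
  ext ⟨x, y⟩
  simp only [coprod2, Matrix.add_apply, Matrix.kronecker_apply, raiseOp_apply,
    Matrix.diagonal_apply, Matrix.one_apply, Pi.add_apply, Pi.sub_apply,
    Pi.smul_apply, smul_eq_mul, ket_apply, and_mul]
  congr 1
  · by_cases h1 : y = l
    · simp only [h1, if_true]; ring
    · simp [h1]
  · by_cases h1 : x = k
    · simp only [h1, if_true]; ring
    · simp [h1]

section
variable {p s : Fin (2 * n)} (hps : rho p = rho s + 1)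
include hps
lemma ne_of_rho_succ : p ≠ s := by rintro rfl; omega
lemma ne_op_of_rho_succ : p ≠ op s := by rintro rfl; rw [rho_op] at hps; omega

set_option linter.unusedSimpArgs false in
lemma coprod2_mulVec_ket_op (q : K) (i : Fin (2 * n)) :
    coprod2 (grpLike q p s) (raiseOp K p s) *ᵥ ket K i (op i) =
      (if i = s then q • ket K p (op s) else 0) - (if i = op p then q • ket K (op s) p else 0)
      + (if i = op s then ket K (op s) p else 0) - (if i = p then ket K p (op s) else 0) := by
  have h1 : p ≠ s := ne_of_rho_succ hps
  have h2 : p ≠ op s := ne_op_of_rho_succ hps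
  have h3 : s ≠ op p := fun h => h2 (eq_op_comm.1 h)
  have h4 := op_ne_self p
  have h5 := op_ne_self s
  have g1 : grpLike q p s (op s) = q := by simp [grpLike]
  have g2 : grpLike q p s p = q := by simp [grpLike]
  rw [coprod2_mulVec_ket]
  have c1 : op i = s ↔ i = op s := by rw [eq_op_comm, eq_comm]
  have c2 : op i = op p ↔ i = p := Fin.rev_inj
  simp only [c1, c2]
  by_cases k1 : i = s
  · subst k1
    simp [h1, h1.symm, h2, h3, h4, h4.symm, h5, h5.symm, g1, g2]
  by_cases k2 : i = op p
  · subst k2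
    simp [k1, h1, h1.symm, h2, h3, h4, h4.symm, h5, h5.symm, g1, g2]
  by_cases k3 : i = op s
  · subst k3
    simp [h1, h1.symm, h2.symm, h3, h4, h4.symm, h5, h5.symm, g1, g2]
  by_cases k4 : i = p
  · subst k4
    simp [h1, h1.symm, h2, h3, h4, h4.symm, h5, h5.symm, g1, g2]
  simp [k1, k2, k3, k4]

lemma coprod2_mulVec_sum (q : K) (f : Fin (2 * n) → K) :
    coprod2 (grpLike q p s) (raiseOp K p s) *ᵥ (∑ i, f i • ket K i (op i)) =
      (f s * q - f p) • ket K p (op s) - (f (op p) * q - f (op s)) • ket K (op s) p := by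
  simp only [Matrix.mulVec_sum, Matrix.mulVec_smul, coprod2_mulVec_ket_op hps, smul_add, smul_sub,
    smul_ite, smul_zero, Finset.sum_add_distrib, Finset.sum_sub_distrib, Finset.sum_ite_eq',
    Finset.mem_univ, if_true]
  module

lemma coprod2_mulVec_halfCup {q : K} (hq : q ≠ 0) (l : Fin (2 * n)) :
    coprod2 (grpLike q p s) (raiseOp K p s) *ᵥ halfCup q l =
      (if rho l = rho p then q ^ rho p else 0) • ket K p (op s)
      - (if rho l = -rho s then q ^ (-rho s) else 0) • ket K (op s) p := by
  have hc : halfCup q l = ∑ i, (if rho i < rho l then q ^ rho i else 0) • ket K i (op i) := by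
    simp only [halfCup, ite_smul, zero_smul]
  rw [hc, coprod2_mulVec_sum hps]
  simp only [ite_mul, zero_mul, rho_op]
  have e1 : (if rho s < rho l then q ^ rho s * q else 0) - (if rho p < rho l then q ^ rho p else 0)
      = (if rho l = rho p then q ^ rho p else 0) := by
    have : q ^ rho p = q ^ rho s * q := by rw [hps, zpow_add_one₀ hq]
    rw [this]
    split_ifs <;> first | omega | simp
  have e2 : (if -rho p < rho l then q ^ (-rho p) * q else 0)
      - (if -rho s < rho l then q ^ (-rho s) else 0)
      = (if rho l = -rho s then q ^ (-rho s) else 0) := by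
    have : q ^ (-rho s) = q ^ (-rho p) * q := by rw [← zpow_add_one₀ hq]; congr 1; omega
    rw [this]
    split_ifs <;> first | omega | simp
  rw [← e1, ← e2]

/-- Passing from `s` to `p` adds the summand of `s`, and also that of `s'` when `ρ_s = 0`. -/
lemma halfCup_succ (q : K) :
    halfCup q p = halfCup q s
      + q ^ rho s • (ket K s (op s) + (if rho s = 0 then (1 : K) else 0) • ket K (op s) s) := by
  have and_mul : ∀ (P Q : Prop) [Decidable P] [Decidable Q],
      (if P ∧ Q then (1 : K) else 0) = (if P then 1 else 0) * (if Q then 1 else 0) := by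
    intro P Q _ _
    by_cases hP : P <;> by_cases hQ : Q <;> simp [hP, hQ]
  ext ⟨x, y⟩
  simp only [halfCup_apply, ket_apply, Pi.add_apply, Pi.smul_apply, smul_eq_mul]
  by_cases hy : y = op x
  · subst hy
    by_cases hx : x = s
    · subst hx
      simp [hps, (op_ne_self x).symm]
    · have h1 : op x = op s ↔ x = s := Fin.rev_inj
      by_cases hx' : x = op s
      · subst hx'
        have h2 := op_ne_self s
        have h3 : (-rho s < rho p ∧ ¬ (-rho s < rho s)) ↔ rho s = 0 := by omega
        simp only [true_and, h2, op_op, rho_op]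
        simp only [if_false, zero_add, if_true, mul_one, false_and]
        split_ifs <;> first | omega | simp_all
      · have h2 : rho x ≠ rho s := fun h => by
          rcases eq_or_eq_op_of_rho_eq h with h | h <;> contradiction
        have h3 : rho x < rho p ↔ rho x < rho s := by omega
        simp [hx, hx', h3]
  · have h1 : ¬ (x = s ∧ y = op s) := by rintro ⟨rfl, rfl⟩; exact hy rfl
    have h2 : ¬ (x = op s ∧ y = s) := by rintro ⟨rfl, rfl⟩; exact hy (op_op _).symm
    simp [hy, h1, h2]

set_option linter.unusedSimpArgs false in
set_option maxHeartbeats 1000000 in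
/-- The braid matrix commutes with the raising operators. The indices `k`, `l` of the vector on
which the two sides are compared are each either one of `s`, `p`, `s'`, `p'` or killed by the
operator. -/
lemma stdR_comm_coprod2 {q : K} (hq : q ≠ 0) :
    stdR n q * coprod2 (grpLike q p s) (raiseOp K p s)
      = coprod2 (grpLike q p s) (raiseOp K p s) * stdR n q := by
  have h1 : p ≠ s := ne_of_rho_succ hps
  have h2 : p ≠ op s := ne_op_of_rho_succ hps
  have h3 : s ≠ op p := fun h => h2 (eq_op_comm.1 h)
  have h4 := op_ne_self p
  have h5 := op_ne_self s
  have h6 : op p ≠ op s := fun h => h1 (Fin.rev_inj.1 h)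
  have ops : ∀ i : Fin (2 * n), op (op i) = i := op_op
  have oi : ∀ i j : Fin (2 * n), op i = op j ↔ i = j := fun i j => Fin.rev_inj
  have hp1 : q ^ rho p = q ^ rho s * q := by rw [hps, zpow_add_one₀ hq]
  have hp2 : q ^ (-rho p) = (q ^ rho s)⁻¹ * q⁻¹ := by rw [zpow_neg, hp1, mul_inv]
  have hp3 : q ^ (-rho s) = (q ^ rho s)⁻¹ := by rw [zpow_neg]
  have gp : grpLike q p s p = q := by simp [grpLike]
  have gs' : grpLike q p s (op s) = q := by simp [grpLike]
  have gs : grpLike q p s s = q⁻¹ := by simp [grpLike, h1.symm, h5.symm]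
  have gp' : grpLike q p s (op p) = q⁻¹ := by simp [grpLike, h4, h6]
  have go : ∀ m, m ≠ p → m ≠ s → m ≠ op p → m ≠ op s → grpLike q p s m = 1 := by
    intro m k1 k2 k3 k4; simp [grpLike, k1, k2, k3, k4]
  have hQ : q ^ rho s ≠ 0 := zpow_ne_zero _ hq
  have rne : ∀ m, m ≠ p → m ≠ s → m ≠ op p → m ≠ op s →
      rho m ≠ rho p ∧ rho m ≠ rho s ∧ rho m ≠ - rho p ∧ rho m ≠ - rho s := by
    intro m k1 k2 k3 k4
    refine ⟨fun h => ?_, fun h => ?_, fun h => ?_, fun h => ?_⟩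
    · rcases eq_or_eq_op_of_rho_eq h with h | h <;> contradiction
    · rcases eq_or_eq_op_of_rho_eq h with h | h <;> contradiction
    · rw [← rho_op] at h
      rcases eq_or_eq_op_of_rho_eq h with h | h
      · contradiction
      · rw [op_op] at h; contradiction
    · rw [← rho_op] at h
      rcases eq_or_eq_op_of_rho_eq h with h | h
      · contradiction
      · rw [op_op] at h; contradiction
  have hc := coprod2_mulVec_halfCup hps hq
  have hs1 := halfCup_succ hps q
  have hs2 : halfCup q (op s) = halfCup q (op p) + q ^ rho (op p) • (ket K (op p) (op (op p)) +
      (if rho (op p) = 0 then (1 : K) else 0) • ket K (op (op p)) (op p)) :=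
    halfCup_succ (by rw [rho_op, rho_op]; omega) q
  rw [rho_op, op_op, hp2] at hs2
  have ne_op : ∀ i j : Fin (2 * n), i ≠ op j → j ≠ op i := fun i j h h' => h (eq_op_comm.1 h')
  refine mulVec_ket_ext fun k l => ?_
  rw [← Matrix.mulVec_mulVec, ← Matrix.mulVec_mulVec]
  simp only [coprod2_mulVec_ket, stdR_mulVec_ket hq, Matrix.mulVec_add, Matrix.mulVec_sub,
    Matrix.mulVec_smul, hc]
  have n1 := h1.symm
  have n2 := h2.symm
  have n3 := h3.symm
  have n4 := h4.symm
  have n5 := h5.symm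
  have n6 := h6.symm
  have ro : ∀ i : Fin (2 * n), rho (op i) = - rho i := rho_op
  have a1 : ∀ m : Fin (2 * n), m ≠ op m := fun m => (op_ne_self m).symm
  have a2 : ∀ m : Fin (2 * n), op m ≠ m := fun m => (op_ne_self m)
  have cases4 : ∀ m : Fin (2 * n), (m = s ∨ m = p ∨ m = op s ∨ m = op p) ∨
      (m ≠ s ∧ m ≠ p ∧ m ≠ op s ∧ m ≠ op p) := by intro m; tauto
  rcases cases4 k with hk | ⟨k1, k2, k3, k4⟩ <;> rcases cases4 l with hl | ⟨l1, l2, l3, l4⟩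
  · rcases hk with hk | hk | hk | hk <;> rcases hl with hl | hl | hl | hl <;> rw [hk, hl] <;>
    simp only [h1, h2, h3, h6, n1, n2, n3, n6, gp, gp', gs, gs', if_true, if_false,
      ops, oi, ro, a1, a2, one_smul, zero_smul, sub_zero, add_zero, zero_add, zero_sub, smul_zero,
      hs1, hs2, lt_self_iff_false] <;>
    split_ifs <;>
    -- If `ρ_p` or `ρ_s` vanishes, an index and its opposite share this value of `ρ`, and the
    -- corresponding power of `q` has to be replaced by `1`.
    first
      | (exfalso; omega)
      | (have z : rho p = 0 := by omega
         simp only [z, zpow_zero]; match_scalars <;> field_simp <;> ring1)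
      | (have z : rho s = 0 := by omega
         simp only [z, neg_zero, zpow_zero]; match_scalars <;> field_simp <;> ring1)
      | (try simp only [hp1, hp2, hp3]
         match_scalars <;> field_simp <;> ring1)
  · have l5 := go l l2 l1 l4 l3
    have l6 := ne_op _ _ l3
    have l7 := ne_op _ _ l4
    have l8 := l1.symm
    have l9 := l2.symm
    have r := rne l l2 l1 l4 l3
    rcases hk with hk | hk | hk | hk <;> rw [hk] <;>
    simp only [l1, l2, l3, l4, l5, l6, l7, l8, l9, h1, h2, h3, h6, n1, n2, n3, n6,
      gp, gp', gs, gs', if_true, if_false,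
      ops, oi, ro, a1, a2, one_smul, zero_smul, sub_zero, add_zero, zero_add, zero_sub, smul_zero,
      hs1, hs2, lt_self_iff_false] <;>
    split_ifs <;>
    first
      | (exfalso; omega)
      | (match_scalars <;> field_simp)
  · have k5 := go k k2 k1 k4 k3
    have k6 := ne_op _ _ k3
    have k7 := ne_op _ _ k4
    have k8 := k1.symm
    have k9 := k2.symm
    have r := rne k k2 k1 k4 k3
    rcases hl with hk | hk | hk | hk <;> rw [hk] <;>
    simp only [k1, k2, k3, k4, k5, k6, k7, k8, k9, h1, h2, h3, h6, n1, n2, n3, n6,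
      gp, gp', gs, gs', if_true, if_false,
      ops, oi, ro, a1, a2, one_smul, zero_smul, sub_zero, add_zero, zero_add, zero_sub, smul_zero,
      hs1, hs2, lt_self_iff_false] <;>
    split_ifs <;>
    first
      | (exfalso; omega)
      | (match_scalars <;> field_simp)
  · have k5 := go k k2 k1 k4 k3
    have l5 := go l l2 l1 l4 l3
    have r := rne l l2 l1 l4 l3
    have r1 : rho l ≠ rho p := r.1
    have r2 : rho l ≠ - rho s := r.2.2.2
    simp only [k1, k2, k3, k4, l1, l2, l3, l4, r1, r2, if_false,
      zero_smul, smul_zero, sub_zero, add_zero, Matrix.mulVec_zero]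

lemma coprod2_mulVec_cup {q : K} (hq : q ≠ 0) :
    coprod2 (grpLike q p s) (raiseOp K p s) *ᵥ cup n q = 0 := by
  have e1 : q ^ rho p = q ^ rho s * q := by rw [hps, zpow_add_one₀ hq]
  have e2 : q ^ (-rho s) = q ^ (-rho p) * q := by rw [← zpow_add_one₀ hq]; congr 1; omega
  rw [cup, coprod2_mulVec_sum hps]
  simp [rho_op, e1, e2]

lemma cupCap_comm_coprod2 {q : K} (hq : q ≠ 0) :
    cupCap n q * coprod2 (grpLike q p s) (raiseOp K p s)
      = coprod2 (grpLike q p s) (raiseOp K p s) * cupCap n q := by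
  have h1 : p ≠ s := ne_of_rho_succ hps
  have h2 : p ≠ op s := ne_op_of_rho_succ hps
  have h3 : s ≠ op p := fun h => h2 (eq_op_comm.1 h)
  have g1 : grpLike q p s s = q⁻¹ := by simp [grpLike, h1.symm, (op_ne_self s).symm]
  have g2 : grpLike q p s (op p) = q⁻¹ := by
    simp [grpLike, op_ne_self, Fin.rev_inj, h1]
  have e1 : q ^ rho p = q ^ rho s * q := by rw [hps, zpow_add_one₀ hq]
  have hQ : q ^ rho s ≠ 0 := zpow_ne_zero _ hq
  refine mulVec_ket_ext fun k l => ?_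
  rw [← Matrix.mulVec_mulVec, ← Matrix.mulVec_mulVec, cupCap_mulVec_ket hq, Matrix.mulVec_smul,
    coprod2_mulVec_cup hps hq, smul_zero, coprod2_mulVec_ket]
  simp only [Matrix.mulVec_add, Matrix.mulVec_sub, Matrix.mulVec_smul, cupCap_mulVec_ket hq,
    smul_smul, ← sub_smul, ← add_smul]
  convert zero_smul K (cup n q)
  have c1 : l = op (op s) ↔ l = s := by rw [op_op]
  have c2 : p = op k ↔ k = op p := eq_op_comm
  have c3 : op s = op k ↔ k = s := by rw [eq_comm]; exact Fin.rev_inj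
  simp only [c1, c2, c3]
  by_cases k1 : k = s
  · subst k1
    by_cases l1 : l = op p
    · subst l1
      simp [h3, h3.symm, g2, e1]
      field_simp
      simp
    · simp [h3, l1]
  · by_cases k2 : k = op p
    · subst k2
      by_cases l1 : l = s
      · subst l1
        simp [k1, h3, g1, rho_op, e1]
      · simp [k1, l1]
    · simp [k1, k2]

end

lemma raiseOp_transpose (p s : Fin (2 * n)) : (raiseOp K p s)ᵀ = raiseOp K s p := by
  ext i j
  simp only [Matrix.transpose_apply, raiseOp_apply, and_comm]

lemma coprod2_transpose (ω : Fin (2 * n) → K) (M : Matrix (Fin (2 * n)) (Fin (2 * n)) K) :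
    (coprod2 ω M)ᵀ = coprod2 ω Mᵀ := by
  rw [coprod2, Matrix.transpose_add, ← Matrix.kroneckerMap_transpose,
    ← Matrix.kroneckerMap_transpose,
    Matrix.diagonal_transpose, Matrix.transpose_one, coprod2]

/-- The coproduct of a simple group-like element acting on `V ⊗ V`. -/
def grp2 (ω : Fin (2 * n) → K) : Op2 K n := Matrix.diagonal ω ⊗ₖ Matrix.diagonal ω

lemma grp2_apply (ω : Fin (2 * n) → K) :
    grp2 ω = Matrix.diagonal fun x : Fin (2 * n) × Fin (2 * n) => ω x.1 * ω x.2 := by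
  rw [grp2, Matrix.diagonal_kronecker_diagonal]

lemma grpLike_mul_op {q : K} (hq : q ≠ 0) {p s : Fin (2 * n)} (hps : rho p = rho s + 1)
    (m : Fin (2 * n)) : grpLike q p s m * grpLike q p s (op m) = 1 := by
  have h1 : p ≠ s := ne_of_rho_succ hps
  have h2 : p ≠ op s := ne_op_of_rho_succ hps
  have h3 : s ≠ op p := fun h => h2 (eq_op_comm.1 h)
  have c : ∀ i, op m = i ↔ m = op i := fun i => by rw [eq_op_comm, eq_comm]
  have h4 := op_ne_self p
  have h5 := op_ne_self s
  simp only [grpLike, c]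
  by_cases k1 : m = s
  · subst k1; simp [h1.symm, h5.symm, hq]
  by_cases k2 : m = p
  · subst k2; simp [h1, h4.symm, h2, hq]
  by_cases k3 : m = op s
  · subst k3; simp [hq, h2.symm, h5, Fin.rev_inj, h1.symm]
  by_cases k4 : m = op p
  · subst k4; simp [hq, h3.symm, h4, Fin.rev_inj, h1]
  simp [k1, k2, k3, k4]

/-- The operators on `V ⊗ V` that commute with the quantum group. -/
def invariants2 (n : ℕ) (q : K) : Subalgebra K (Op2 K n) :=
  Subalgebra.centralizer K {X | ∃ p s : Fin (2 * n), rho p = rho s + 1 ∧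
    (X = coprod2 (grpLike q p s) (raiseOp K p s) ∨ X = coprod2 (grpLike q p s) (raiseOp K s p) ∨
      X = grp2 (grpLike q p s))}

lemma mem_invariants2 {q : K} {A : Op2 K n} :
    A ∈ invariants2 n q ↔ ∀ p s : Fin (2 * n), rho p = rho s + 1 →
      A * coprod2 (grpLike q p s) (raiseOp K p s) = coprod2 (grpLike q p s) (raiseOp K p s) * A ∧
      A * coprod2 (grpLike q p s) (raiseOp K s p) = coprod2 (grpLike q p s) (raiseOp K s p) * A ∧
      A * grp2 (grpLike q p s) = grp2 (grpLike q p s) * A := by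
  rw [invariants2, Subalgebra.mem_centralizer_iff]
  constructor
  · intro h p s hps
    exact ⟨(h _ ⟨p, s, hps, Or.inl rfl⟩).symm, (h _ ⟨p, s, hps, Or.inr (Or.inl rfl)⟩).symm,
      (h _ ⟨p, s, hps, Or.inr (Or.inr rfl)⟩).symm⟩
  · rintro h X ⟨p, s, hps, rfl | rfl | rfl⟩
    exacts [(h p s hps).1.symm, (h p s hps).2.1.symm, (h p s hps).2.2.symm]

/-- For a symmetric matrix, commuting with the lowering operators follows from commuting with the
raising operators. -/
lemma mem_invariants2_of_symm {q : K} {A : Op2 K n} (hA : Aᵀ = A)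
    (h1 : ∀ p s : Fin (2 * n), rho p = rho s + 1 →
      A * coprod2 (grpLike q p s) (raiseOp K p s) = coprod2 (grpLike q p s) (raiseOp K p s) * A)
    (h2 : ∀ p s : Fin (2 * n), rho p = rho s + 1 → ∀ x y, A x y ≠ 0 →
      grpLike q p s x.1 * grpLike q p s x.2 = grpLike q p s y.1 * grpLike q p s y.2) :
    A ∈ invariants2 n q := by
  refine mem_invariants2.2 fun p s hps => ⟨h1 p s hps, ?_, ?_⟩
  · have := congrArg Matrix.transpose (h1 p s hps)
    rw [Matrix.transpose_mul, Matrix.transpose_mul, coprod2_transpose, raiseOp_transpose,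
      hA] at this
    exact this.symm
  · ext x y
    rw [grp2_apply, Matrix.mul_diagonal, Matrix.diagonal_mul]
    by_cases h : A x y = 0
    · simp [h]
    · rw [h2 p s hps x y h, mul_comm]

lemma stdR_mem {q : K} (hq : q ≠ 0) : stdR n q ∈ invariants2 n q := by
  refine mem_invariants2_of_symm (stdR_transpose q) (fun p s hps => stdR_comm_coprod2 hps hq) ?_
  rintro p s hps ⟨x, y⟩ ⟨k, l⟩ h
  simp only [stdR, Matrix.of_apply] at h
  by_cases h1 : x = l ∧ y = k
  · rw [h1.1, h1.2, mul_comm]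
  by_cases h2 : (x, y) = (k, l)
  · rw [h2]
  by_cases h3 : y = op x ∧ l = op k
  · simp only [h3.1, h3.2, grpLike_mul_op hq hps]
  · simp [h1, h2, h3] at h

lemma cupCap_mem {q : K} (hq : q ≠ 0) : cupCap n q ∈ invariants2 n q := by
  refine mem_invariants2_of_symm (cupCap_transpose q) (fun p s hps => cupCap_comm_coprod2 hps hq) ?_
  rintro p s hps ⟨x, y⟩ ⟨k, l⟩ h
  simp only [cupCap, Matrix.of_apply] at h
  by_cases h3 : y = op x ∧ l = op k
  · simp only [h3.1, h3.2, grpLike_mul_op hq hps]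
  · simp [h3] at h

end

/-! ### Operators on `V ⊗ V ⊗ V` commuting with the quantum group -/

section

variable {K : Type*} [Field K] {n : ℕ}

/-- `leg12` as a homomorphism of algebras. -/
def leg12Hom (K : Type*) [Field K] (n : ℕ) : Op2 K n →ₐ[K] Op3 K n :=
  AlgHom.ofLinearMap
    { toFun := leg12
      map_add' := fun A B => by
        ext x y; simp only [leg12, Matrix.of_apply, Matrix.add_apply]; split_ifs <;> simp
      map_smul' := fun c A => by
        ext x y; simp [leg12] }
    (by
      ext x y
      simp only [leg12, LinearMap.coe_mk, AddHom.coe_mk, Matrix.of_apply, Matrix.one_apply,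
        Prod.ext_iff]
      split_ifs <;> simp_all)
    (fun A B => by
      ext ⟨x1, x2, x3⟩ ⟨y1, y2, y3⟩
      simp only [leg12, LinearMap.coe_mk, AddHom.coe_mk, Matrix.of_apply, Matrix.mul_apply,
        Fintype.sum_prod_type]
      by_cases h : x3 = y3
      · subst h
        simp
      · simp [h])

/-- `leg23` as a homomorphism of algebras. -/
def leg23Hom (K : Type*) [Field K] (n : ℕ) : Op2 K n →ₐ[K] Op3 K n :=
  AlgHom.ofLinearMap
    { toFun := leg23
      map_add' := fun A B => by
        ext x y; simp only [leg23, Matrix.of_apply, Matrix.add_apply]; split_ifs <;> simp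
      map_smul' := fun c A => by
        ext x y; simp [leg23] }
    (by
      ext x y
      simp only [leg23, LinearMap.coe_mk, AddHom.coe_mk, Matrix.of_apply, Matrix.one_apply,
        Prod.ext_iff]
      split_ifs <;> simp_all)
    (fun A B => by
      ext ⟨x1, x2, x3⟩ ⟨y1, y2, y3⟩
      simp only [leg23, LinearMap.coe_mk, AddHom.coe_mk, Matrix.of_apply, Matrix.mul_apply,
        Fintype.sum_prod_type]
      by_cases h : x1 = y1
      · subst h
        simp
      · simp [h])

lemma leg12Hom_apply (A : Op2 K n) : leg12Hom K n A = leg12 A := rfl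
lemma leg23Hom_apply (A : Op2 K n) : leg23Hom K n A = leg23 A := rfl

lemma leg23_eq_kronecker (A : Op2 K n) :
    leg23 A = (1 : Matrix (Fin (2 * n)) (Fin (2 * n)) K) ⊗ₖ A := by
  ext x y
  simp [leg23, Matrix.one_apply]

lemma leg12_eq_reindex (A : Op2 K n) :
    leg12 A = Matrix.reindexAlgEquiv K K (Equiv.prodAssoc _ _ _)
      (A ⊗ₖ (1 : Matrix (Fin (2 * n)) (Fin (2 * n)) K)) := by
  ext x y
  simp [leg12, Matrix.one_apply]

/-- The action on `V ⊗ V ⊗ V` of an element with the coproduct `M ⊗ ω + 1 ⊗ M`. -/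
def coprod3 (ω : Fin (2 * n) → K) (M : Matrix (Fin (2 * n)) (Fin (2 * n)) K) : Op3 K n :=
  M ⊗ₖ grp2 ω + 1 ⊗ₖ coprod2 ω M

/-- Coassociativity of the coproduct. -/
lemma coprod3_eq_reindex (ω : Fin (2 * n) → K) (M : Matrix (Fin (2 * n)) (Fin (2 * n)) K) :
    coprod3 ω M = Matrix.reindexAlgEquiv K K (Equiv.prodAssoc _ _ _)
      (coprod2 ω M ⊗ₖ Matrix.diagonal ω + 1 ⊗ₖ M) := by
  have h1 : (1 : Op2 K n) = (1 : Matrix (Fin (2 * n)) (Fin (2 * n)) K) ⊗ₖ 1 :=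
    Matrix.one_kronecker_one.symm
  rw [map_add, h1]
  simp only [Matrix.coe_reindexAlgEquiv, coprod2, Matrix.add_kronecker, coprod3, grp2,
    Matrix.kronecker_add]
  have := Matrix.kronecker_assoc (1 : Matrix (Fin (2 * n)) (Fin (2 * n)) K)
    (1 : Matrix (Fin (2 * n)) (Fin (2 * n)) K) M
  rw [this, ← Matrix.kronecker_assoc, ← Matrix.kronecker_assoc, ← add_assoc]
  rfl

/-- The operators on `V ⊗ V ⊗ V` that commute with the quantum group. -/
def invariants3 (n : ℕ) (q : K) : Subalgebra K (Op3 K n) :=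
  Subalgebra.centralizer K {X | ∃ p s : Fin (2 * n), rho p = rho s + 1 ∧
    (X = coprod3 (grpLike q p s) (raiseOp K p s) ∨ X = coprod3 (grpLike q p s) (raiseOp K s p))}

lemma mem_invariants3 {q : K} {A : Op3 K n} :
    A ∈ invariants3 n q ↔ ∀ p s : Fin (2 * n), rho p = rho s + 1 →
      coprod3 (grpLike q p s) (raiseOp K p s) * A = A * coprod3 (grpLike q p s) (raiseOp K p s) ∧
      coprod3 (grpLike q p s) (raiseOp K s p) * A
        = A * coprod3 (grpLike q p s) (raiseOp K s p) := by
  rw [invariants3, Subalgebra.mem_centralizer_iff]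
  constructor
  · intro h p s hps
    exact ⟨h _ ⟨p, s, hps, Or.inl rfl⟩, h _ ⟨p, s, hps, Or.inr rfl⟩⟩
  · rintro h X ⟨p, s, hps, rfl | rfl⟩
    exacts [(h p s hps).1, (h p s hps).2]

lemma leg23_comm_coprod3 {A : Op2 K n} {ω : Fin (2 * n) → K}
    {M : Matrix (Fin (2 * n)) (Fin (2 * n)) K} (h1 : A * coprod2 ω M = coprod2 ω M * A)
    (h2 : A * grp2 ω = grp2 ω * A) : coprod3 ω M * leg23 A = leg23 A * coprod3 ω M := by
  rw [leg23_eq_kronecker, coprod3, add_mul, mul_add, ← Matrix.mul_kronecker_mul,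
    ← Matrix.mul_kronecker_mul, ← Matrix.mul_kronecker_mul, ← Matrix.mul_kronecker_mul, h1, h2]
  simp only [one_mul, mul_one]

lemma leg12_comm_coprod3 {A : Op2 K n} {ω : Fin (2 * n) → K}
    {M : Matrix (Fin (2 * n)) (Fin (2 * n)) K} (h1 : A * coprod2 ω M = coprod2 ω M * A) :
    coprod3 ω M * leg12 A = leg12 A * coprod3 ω M := by
  rw [leg12_eq_reindex, coprod3_eq_reindex, ← map_mul, ← map_mul]
  congr 1
  rw [add_mul, mul_add, ← Matrix.mul_kronecker_mul,
    ← Matrix.mul_kronecker_mul, ← Matrix.mul_kronecker_mul, ← Matrix.mul_kronecker_mul, h1]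
  simp only [one_mul, mul_one]

lemma leg12_mem {q : K} {A : Op2 K n} (hA : A ∈ invariants2 n q) : leg12 A ∈ invariants3 n q := by
  rw [mem_invariants2] at hA
  exact mem_invariants3.2 fun p s hps =>
    ⟨leg12_comm_coprod3 (hA p s hps).1, leg12_comm_coprod3 (hA p s hps).2.1⟩

lemma leg23_mem {q : K} {A : Op2 K n} (hA : A ∈ invariants2 n q) : leg23 A ∈ invariants3 n q := by
  rw [mem_invariants2] at hA
  exact mem_invariants3.2 fun p s hps =>
    ⟨leg23_comm_coprod3 (hA p s hps).1 (hA p s hps).2.2,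
      leg23_comm_coprod3 (hA p s hps).2.1 (hA p s hps).2.2⟩

lemma coprod3_mulVec_ket3 (ω : Fin (2 * n) → K) (p s k l m : Fin (2 * n)) :
    coprod3 ω (raiseOp K p s) *ᵥ ket3 K k l m =
      (ω l * ω m) • ((if k = s then (1 : K) else 0) • ket3 K p l m
        - (if k = op p then (1 : K) else 0) • ket3 K (op s) l m)
      + ω m • ((if l = s then (1 : K) else 0) • ket3 K k p m
        - (if l = op p then (1 : K) else 0) • ket3 K k (op s) m)
      + ((if m = s then (1 : K) else 0) • ket3 K k l p
        - (if m = op p then (1 : K) else 0) • ket3 K k l (op s)) := by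
  have and_mul : ∀ (P Q : Prop) [Decidable P] [Decidable Q],
      (if P ∧ Q then (1 : K) else 0) = (if P then 1 else 0) * (if Q then 1 else 0) := by
    intro P Q _ _
    by_cases hP : P <;> by_cases hQ : Q <;> simp [hP, hQ]
  have ket3_apply : ∀ (k l m x y z : Fin (2 * n)), ket3 K k l m (x, y, z) =
      (if x = k then 1 else 0) * ((if y = l then 1 else 0) * (if z = m then 1 else 0)) := by
    intro k l m x y z
    rw [ket3, Pi.single_apply, ← and_mul, ← and_mul]
    simp only [Prod.mk.injEq]
  rw [mulVec_ket3]
  ext ⟨x, y, z⟩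
  simp only [coprod3, coprod2, grp2_apply, Matrix.add_apply, Matrix.kronecker_apply, raiseOp_apply,
    Matrix.diagonal_apply, Matrix.one_apply, Pi.add_apply, Pi.sub_apply,
    Pi.smul_apply, smul_eq_mul, ket3_apply, and_mul, Prod.mk.injEq, mul_add, add_assoc]
  congr 1
  · by_cases h1 : y = l <;> by_cases h2 : z = m
    · simp only [h1, h2, if_true, and_self]; ring
    all_goals simp [h1, h2]
  congr 1
  · by_cases h1 : x = k <;> by_cases h2 : z = m
    · simp only [h1, h2, if_true]; ring
    all_goals simp [h1, h2]
  · by_cases h1 : x = k <;> by_cases h2 : y = l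
    · simp only [h1, h2, if_true]; ring
    all_goals simp [h1, h2]

end

/-! ### Invariant operators are determined on few vectors -/

section

variable {K : Type*} [Field K] {n : ℕ}

lemma rho_le (i : Fin (2 * n)) : rho i ≤ (n : ℤ) - 1 := by
  have := i.isLt
  simp only [rho, pos]
  split_ifs <;> omega

lemma neg_rho_le (i : Fin (2 * n)) : -rho i ≤ (n : ℤ) - 1 := by
  rw [← rho_op]; exact rho_le _

lemma exists_rho_eq {m : ℤ} (h1 : m ≤ (n : ℤ) - 1) (h2 : -m ≤ (n : ℤ) - 1) :
    ∃ i : Fin (2 * n), rho i = m := by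
  by_cases hm : 0 ≤ m
  · refine ⟨⟨(n - 1 - m).toNat, by omega⟩, ?_⟩
    simp only [rho, pos]
    split_ifs <;> omega
  · refine ⟨⟨(n - m).toNat, by omega⟩, ?_⟩
    simp only [rho, pos]
    split_ifs <;> omega

lemma eq_of_rho_eq {i j : Fin (2 * n)} (h : rho i = rho j) (h0 : rho j ≠ 0) : i = j := by
  rcases eq_or_eq_op_of_rho_eq h with h1 | h1
  · exact h1
  · rw [h1, rho_op] at h; omega

lemma grpLike_ne_zero {q : K} (hq : q ≠ 0) (p s m : Fin (2 * n)) : grpLike q p s m ≠ 0 := by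
  unfold grpLike
  split_ifs <;> simp [hq]

section
variable (hn : 2 ≤ n) {t : Fin (2 * n)} (ht : rho t = (n : ℤ) - 1)
include hn ht

/-- The vectors `v_1 ⊗ v_j ⊗ v_{2n}` generate `V ⊗ V ⊗ V` under the quantum group: the lowering
operators kill `v_{2n}`, so they move the first factor, and afterwards the raising operators move
the last factor. Hence an invariant operator is determined by its values on these vectors. -/
lemma eq_zero_of_mem_invariants3 {q : K} (hq : q ≠ 0) {D : Op3 K n} (hD : D ∈ invariants3 n q)
    (h : ∀ j, D *ᵥ ket3 K t j (op t) = 0) : D = 0 := by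
  rw [mem_invariants3] at hD
  have step1 : ∀ (m : ℕ) (k : Fin (2 * n)), rho k = (n : ℤ) - 1 - m →
      ∀ l, D *ᵥ ket3 K k l (op t) = 0 := by
    intro m
    induction m with
    | zero =>
      intro k hk l
      have : k = t := eq_of_rho_eq (by rw [hk, ht]; simp) (by omega)
      rw [this, h]
    | succ m ih =>
      intro s hs l
      push_cast at hs
      obtain ⟨p, hp⟩ := exists_rho_eq (n := n) (m := rho s + 1) (by omega)
        (by have := neg_rho_le s; omega)
      have ihp := ih p (by omega)
      have h1 : op t ≠ p := by rintro rfl; rw [rho_op] at hp; have := neg_rho_le s; omega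
      have h2 : op t ≠ op s := by
        intro h; rw [Fin.rev_inj.1 h] at ht; omega
      have h3 : p ≠ op s := ne_op_of_rho_succ hp
      have e := congrArg (· *ᵥ ket3 K p l (op t)) (hD p s hp).2
      simp only [← Matrix.mulVec_mulVec, ihp, Matrix.mulVec_zero, coprod3_mulVec_ket3,
        Matrix.mulVec_add, Matrix.mulVec_sub, Matrix.mulVec_smul, smul_zero, h1, h2, h3, if_true,
        if_false, zero_smul, sub_zero, add_zero, one_smul] at e
      refine (smul_eq_zero.1 e.symm).resolve_left ?_
      exact mul_ne_zero (grpLike_ne_zero hq _ _ _) (grpLike_ne_zero hq _ _ _)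
  have step1' : ∀ k l, D *ᵥ ket3 K k l (op t) = 0 := fun k =>
    step1 ((n : ℤ) - 1 - rho k).toNat k (by have := rho_le k; omega)
  have step2 : ∀ (m : ℕ) (k : Fin (2 * n)), rho k = m - ((n : ℤ) - 1) →
      ∀ i j, D *ᵥ ket3 K i j k = 0 := by
    intro m
    induction m with
    | zero =>
      intro k hk i j
      have : k = op t := eq_of_rho_eq (by rw [hk, rho_op, ht]; simp) (by rw [rho_op]; omega)
      rw [this, step1']
    | succ m ih =>
      intro p hp i j
      push_cast at hp
      obtain ⟨s, hs⟩ := exists_rho_eq (n := n) (m := rho p - 1)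
        (by have := rho_le p; omega) (by omega)
      have hps : rho p = rho s + 1 := by omega
      have ihs := ih s (by omega)
      have h3 : s ≠ op p := fun h => ne_op_of_rho_succ hps (eq_op_comm.1 h)
      have e := congrArg (· *ᵥ ket3 K i j s) (hD p s hps).1
      simp only [← Matrix.mulVec_mulVec, ihs, Matrix.mulVec_zero, coprod3_mulVec_ket3,
        Matrix.mulVec_add, Matrix.mulVec_sub, Matrix.mulVec_smul, smul_zero, h3, if_true,
        if_false, zero_smul, sub_zero, one_smul, zero_add] at e
      exact e.symm
  refine Matrix.ext_of_mulVec_single fun x => ?_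
  obtain ⟨i, j, k⟩ := x
  have := step2 (rho k + ((n : ℤ) - 1)).toNat k (by have := neg_rho_le k; omega) i j
  rw [ket3] at this
  rw [this, Matrix.zero_mulVec]

/-- The vector `v_1 ⊗ v_{2n}` generates `V ⊗ V` under the quantum group, so an invariant operator is
determined by its value on it. -/
lemma eq_zero_of_mem_invariants2 {q : K} (hq : q ≠ 0) {D : Op2 K n} (hD : D ∈ invariants2 n q)
    (h : D *ᵥ ket K t (op t) = 0) : D = 0 := by
  rw [mem_invariants2] at hD
  have step1 : ∀ (m : ℕ) (k : Fin (2 * n)), rho k = (n : ℤ) - 1 - m →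
      D *ᵥ ket K k (op t) = 0 := by
    intro m
    induction m with
    | zero =>
      intro k hk
      have : k = t := eq_of_rho_eq (by rw [hk, ht]; simp) (by omega)
      rw [this, h]
    | succ m ih =>
      intro s hs
      push_cast at hs
      obtain ⟨p, hp⟩ := exists_rho_eq (n := n) (m := rho s + 1) (by omega)
        (by have := neg_rho_le s; omega)
      have ihp := ih p (by omega)
      have h1 : op t ≠ p := by rintro rfl; rw [rho_op] at hp; have := neg_rho_le s; omega
      have h2 : op t ≠ op s := by
        intro h; rw [Fin.rev_inj.1 h] at ht; omega
      have h3 : p ≠ op s := ne_op_of_rho_succ hp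
      have e := congrArg (· *ᵥ ket K p (op t)) (hD p s hp).2.1
      simp only [← Matrix.mulVec_mulVec, ihp, Matrix.mulVec_zero, coprod2_mulVec_ket,
        Matrix.mulVec_smul, h1, h2, h3, if_true,
        if_false, zero_smul, sub_zero, add_zero, one_smul] at e
      exact (smul_eq_zero.1 e).resolve_left (grpLike_ne_zero hq _ _ _)
  have step1' : ∀ k, D *ᵥ ket K k (op t) = 0 := fun k =>
    step1 ((n : ℤ) - 1 - rho k).toNat k (by have := rho_le k; omega)
  have step2 : ∀ (m : ℕ) (k : Fin (2 * n)), rho k = m - ((n : ℤ) - 1) →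
      ∀ i, D *ᵥ ket K i k = 0 := by
    intro m
    induction m with
    | zero =>
      intro k hk i
      have : k = op t := eq_of_rho_eq (by rw [hk, rho_op, ht]; simp) (by rw [rho_op]; omega)
      rw [this, step1']
    | succ m ih =>
      intro p hp i
      push_cast at hp
      obtain ⟨s, hs⟩ := exists_rho_eq (n := n) (m := rho p - 1)
        (by have := rho_le p; omega) (by omega)
      have hps : rho p = rho s + 1 := by omega
      have ihs := ih s (by omega)
      have h3 : s ≠ op p := fun h => ne_op_of_rho_succ hps (eq_op_comm.1 h)
      have e := congrArg (· *ᵥ ket K i s) (hD p s hps).1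
      simp only [← Matrix.mulVec_mulVec, ihs, Matrix.mulVec_zero, coprod2_mulVec_ket,
        Matrix.mulVec_add, Matrix.mulVec_sub, Matrix.mulVec_smul, smul_zero, h3, if_true,
        if_false, zero_smul, sub_zero, one_smul, zero_add] at e
      exact e
  refine mulVec_ket_ext fun i k => ?_
  rw [step2 (rho k + ((n : ℤ) - 1)).toNat k (by have := neg_rho_le k; omega) i, Matrix.zero_mulVec]

end

end

/-! ### The Birman–Murakami–Wenzl relations -/

section

variable {K : Type*} [Field K] {n : ℕ}

/-- Relations of the Birman–Murakami–Wenzl algebra on three strands: `g₁`, `g₂` are the braid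
generators, with the eigenvalues `q`, `-q⁻¹`, `l`, and `e₁`, `e₂` the tangle generators, with the
loop value `δ`. The quadratic relation replaces the formula that expresses `e` through `g - g⁻¹`
with the denominator `q - q⁻¹`, so that `q ^ 2 = 1` is allowed. -/
structure BMWRelations (q l δ : K) {A : Type*} [Ring A] [Algebra K A] (g₁ g₂ e₁ e₂ : A) :
    Prop where
  sq₁ : g₁ * g₁ = 1 + (q - q⁻¹) • g₁ - ((q - q⁻¹) * l) • e₁
  sq₂ : g₂ * g₂ = 1 + (q - q⁻¹) • g₂ - ((q - q⁻¹) * l) • e₂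
  ge₁ : g₁ * e₁ = l • e₁
  ge₂ : g₂ * e₂ = l • e₂
  eg₁ : e₁ * g₁ = l • e₁
  eg₂ : e₂ * g₂ = l • e₂
  ee₁ : e₁ * e₁ = δ • e₁
  ee₂ : e₂ * e₂ = δ • e₂
  braid : g₁ * g₂ * g₁ = g₂ * g₁ * g₂
  gge₁ : g₁ * g₂ * e₁ = e₂ * e₁
  gge₂ : g₂ * g₁ * e₂ = e₁ * e₂
  egg₁ : e₁ * g₂ * g₁ = e₁ * e₂
  egg₂ : e₂ * g₁ * g₂ = e₂ * e₁
  eee₁ : e₁ * e₂ * e₁ = e₁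
  eee₂ : e₂ * e₁ * e₂ = e₂

/-- The vector `v ⊗ v_k` for `v ∈ V ⊗ V`. -/
def tensR (k : Fin (2 * n)) : (Fin (2 * n) × Fin (2 * n) → K) →ₗ[K]
    (Fin (2 * n) × Fin (2 * n) × Fin (2 * n) → K) where
  toFun v x := if x.2.2 = k then v (x.1, x.2.1) else 0
  map_add' v w := by ext x; by_cases h : x.2.2 = k <;> simp [h]
  map_smul' c v := by ext x; by_cases h : x.2.2 = k <;> simp [h]

/-- The vector `v_k ⊗ v` for `v ∈ V ⊗ V`. -/
def tensL (k : Fin (2 * n)) : (Fin (2 * n) × Fin (2 * n) → K) →ₗ[K]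
    (Fin (2 * n) × Fin (2 * n) × Fin (2 * n) → K) where
  toFun v x := if x.1 = k then v (x.2.1, x.2.2) else 0
  map_add' v w := by ext x; by_cases h : x.1 = k <;> simp [h]
  map_smul' c v := by ext x; by_cases h : x.1 = k <;> simp [h]

lemma tensR_ket (i j k : Fin (2 * n)) : tensR k (ket K i j) = ket3 K i j k := by
  ext ⟨x, y, z⟩
  simp only [tensR, LinearMap.coe_mk, AddHom.coe_mk, ket_apply, ket3, Pi.single_apply,
    Prod.mk.injEq]
  by_cases h : z = k <;> simp [h]

lemma tensL_ket (i j k : Fin (2 * n)) : tensL i (ket K j k) = ket3 K i j k := by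
  ext ⟨x, y, z⟩
  simp only [tensL, LinearMap.coe_mk, AddHom.coe_mk, ket_apply, ket3, Pi.single_apply,
    Prod.mk.injEq]
  by_cases h : x = i <;> simp [h]

lemma leg12_mulVec_tensR (A : Op2 K n) (k : Fin (2 * n)) (v : Fin (2 * n) × Fin (2 * n) → K) :
    leg12 A *ᵥ tensR k v = tensR k (A *ᵥ v) := by
  ext ⟨x, y, z⟩
  simp only [leg12, tensR, LinearMap.coe_mk, AddHom.coe_mk, Matrix.mulVec, dotProduct,
    Matrix.of_apply, Fintype.sum_prod_type]
  by_cases h : z = k <;> simp [h]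

lemma leg23_mulVec_tensL (A : Op2 K n) (k : Fin (2 * n)) (v : Fin (2 * n) × Fin (2 * n) → K) :
    leg23 A *ᵥ tensL k v = tensL k (A *ᵥ v) := by
  ext ⟨x, y, z⟩
  simp only [leg23, tensL, LinearMap.coe_mk, AddHom.coe_mk, Matrix.mulVec, dotProduct,
    Matrix.of_apply, Fintype.sum_prod_type]
  by_cases h : x = k <;> simp [h]

lemma leg12_mulVec_ket3 (A : Op2 K n) (i j k : Fin (2 * n)) :
    leg12 A *ᵥ ket3 K i j k = tensR k (A *ᵥ ket K i j) := by
  rw [← tensR_ket, leg12_mulVec_tensR]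

lemma leg23_mulVec_ket3 (A : Op2 K n) (i j k : Fin (2 * n)) :
    leg23 A *ᵥ ket3 K i j k = tensL i (A *ᵥ ket K j k) := by
  rw [← tensL_ket, leg23_mulVec_tensL]

lemma leg12_transpose (A : Op2 K n) : (leg12 A)ᵀ = leg12 Aᵀ := by
  ext x y; simp [leg12, eq_comm]

lemma leg23_transpose (A : Op2 K n) : (leg23 A)ᵀ = leg23 Aᵀ := by
  ext x y; simp [leg23, eq_comm]

lemma tensR_cup (q : K) (k : Fin (2 * n)) :
    tensR k (cup n q) = ∑ i, q ^ rho i • ket3 K i (op i) k := by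
  simp only [cup, map_sum, map_smul, tensR_ket]

lemma tensL_cup (q : K) (k : Fin (2 * n)) :
    tensL k (cup n q) = ∑ i, q ^ rho i • ket3 K k i (op i) := by
  simp only [cup, map_sum, map_smul, tensL_ket]

/-- One of the two zigzag identities between the invariant vector and the invariant form. -/
lemma leg23_cupCap_mulVec_tensR {q : K} (hq : q ≠ 0) (k : Fin (2 * n)) :
    leg23 (cupCap n q) *ᵥ tensR k (cup n q) = tensL k (cup n q) := by
  rw [tensR_cup, Matrix.mulVec_sum, Finset.sum_eq_single k]
  · rw [Matrix.mulVec_smul, leg23_mulVec_ket3, cupCap_mulVec_ket hq, op_op, if_pos rfl, map_smul,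
      smul_smul, rho_op, ← zpow_add₀ hq]
    simp
  · intro i _ hi
    rw [Matrix.mulVec_smul, leg23_mulVec_ket3, cupCap_mulVec_ket hq, op_op, if_neg hi.symm]
    simp
  · simp

/-- The other zigzag identity. -/
lemma leg12_cupCap_mulVec_tensL {q : K} (hq : q ≠ 0) (k : Fin (2 * n)) :
    leg12 (cupCap n q) *ᵥ tensL k (cup n q) = tensR k (cup n q) := by
  rw [tensL_cup, Matrix.mulVec_sum, Finset.sum_eq_single (op k)]
  · rw [Matrix.mulVec_smul, leg12_mulVec_ket3, cupCap_mulVec_ket hq, op_op, if_pos rfl, map_smul,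
      smul_smul, rho_op, ← zpow_add₀ hq]
    simp
  · intro i _ hi
    rw [Matrix.mulVec_smul, leg12_mulVec_ket3, cupCap_mulVec_ket hq, if_neg hi]
    simp
  · simp

/-- The value of a closed loop, `∑ q^{2 ρ_i}`. -/
def loopValue (n : ℕ) (q : K) : K := ∑ i : Fin (2 * n), q ^ rho i * q ^ rho i

lemma cupCap_mulVec_cup {q : K} (hq : q ≠ 0) : cupCap n q *ᵥ cup n q = loopValue n q • cup n q := by
  conv_lhs => rw [cup]
  simp only [Matrix.mulVec_sum, Matrix.mulVec_smul, cupCap_mulVec_ket hq, if_true, smul_smul,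
    loopValue, Finset.sum_smul]

lemma cupCap_mul_cupCap {q : K} (hq : q ≠ 0) :
    cupCap n q * cupCap n q = loopValue n q • cupCap n q := by
  refine mulVec_ket_ext fun k l => ?_
  rw [← Matrix.mulVec_mulVec, Matrix.smul_mulVec, cupCap_mulVec_ket hq, Matrix.mulVec_smul,
    cupCap_mulVec_cup hq, smul_comm]

section
variable (hn : 2 ≤ n) {t : Fin (2 * n)} (ht : rho t = (n : ℤ) - 1)
include ht

lemma halfCup_op_top (q : K) : halfCup q (op t) = 0 := by
  refine Finset.sum_eq_zero fun i _ => ?_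
  rw [if_neg]
  have := neg_rho_le i
  rw [rho_op]
  omega

/-- `R` acts on `v_1 ⊗ V` as a multiple of the flip. -/
lemma stdR_mulVec_top {q : K} (hq : q ≠ 0) (j : Fin (2 * n)) :
    stdR n q *ᵥ ket K t j = (if t = j then q else if j = op t then q⁻¹ else 1) • ket K j t := by
  have h := rho_le j
  rw [stdR_mulVec_ket hq, if_neg (show ¬ rho t < rho j by omega)]
  by_cases hj : j = op t
  · subst hj; rw [halfCup_op_top ht]; simp
  · simp [hj]

/-- `R` acts on `V ⊗ v_{2n}` as a multiple of the flip. -/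
lemma stdR_mulVec_op_top {q : K} (hq : q ≠ 0) (j : Fin (2 * n)) :
    stdR n q *ᵥ ket K j (op t) =
      (if j = op t then q else if op t = op j then q⁻¹ else 1) • ket K (op t) j := by
  have h := neg_rho_le j
  rw [stdR_mulVec_ket hq, if_neg (show ¬ rho j < rho (op t) by rw [rho_op]; omega),
    halfCup_op_top ht]
  simp

lemma stdR_mulVec_top_op {q : K} (hq : q ≠ 0) :
    stdR n q *ᵥ ket K t (op t) = q⁻¹ • ket K (op t) t := by
  rw [stdR_mulVec_top ht hq, if_neg (op_ne_self t).symm, if_pos rfl]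

/-- `R₁₂ R₂₃` moves the invariant vector past a vector `v_{2n}`. -/
lemma leg12_mul_leg23_mulVec_tensR {q : K} (hq : q ≠ 0) :
    leg12 (stdR n q) *ᵥ (leg23 (stdR n q) *ᵥ tensR (op t) (cup n q)) = tensL (op t) (cup n q) := by
  rw [tensR_cup, tensL_cup, Matrix.mulVec_sum, Matrix.mulVec_sum]
  refine Finset.sum_congr rfl fun i _ => ?_
  rw [Matrix.mulVec_smul, leg23_mulVec_ket3, stdR_mulVec_op_top ht hq, map_smul, tensL_ket,
    Matrix.mulVec_smul, Matrix.mulVec_smul, leg12_mulVec_ket3, stdR_mulVec_op_top ht hq,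
    map_smul, tensR_ket, smul_smul, smul_smul, op_op]
  congr 1
  have c : op t = op i ↔ i = t := by rw [eq_comm]; exact Fin.rev_inj
  have c' : op i = op t ↔ i = t := Fin.rev_inj
  have c2 : op t = i ↔ i = op t := eq_comm
  simp only [c, c', c2]
  by_cases h1 : i = t
  · simp [h1, (op_ne_self t).symm, hq]
  · by_cases h2 : i = op t
    · simp [h2, op_ne_self, hq]
    · simp [h1, h2]

include hn

lemma halfCup_top (q : K) : halfCup q t = cup n q - q ^ rho t • ket K t (op t) := by
  have : ∀ i : Fin (2 * n), (if rho i < rho t then q ^ rho i • ket K i (op i) else 0)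
      = q ^ rho i • ket K i (op i) - if i = t then q ^ rho t • ket K t (op t) else 0 := by
    intro i
    by_cases h : i = t
    · simp [h]
    · have h1 : rho i ≠ rho t := fun h' => h (eq_of_rho_eq h' (by omega))
      have h2 := rho_le i
      rw [if_pos (by omega), if_neg h, sub_zero]
  rw [halfCup, Finset.sum_congr rfl fun i _ => this i, Finset.sum_sub_distrib, cup]
  simp

lemma cupCap_mul_stdR {q : K} (hq : q ≠ 0) :
    cupCap n q * stdR n q = q ^ (1 - 2 * (n : ℤ)) • cupCap n q := by
  refine sub_eq_zero.1 (eq_zero_of_mem_invariants2 hn ht hq (sub_mem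
    (mul_mem (cupCap_mem hq) (stdR_mem hq)) (Subalgebra.smul_mem _ (cupCap_mem hq) _)) ?_)
  rw [Matrix.sub_mulVec, ← Matrix.mulVec_mulVec, stdR_mulVec_top_op ht hq, Matrix.mulVec_smul,
    Matrix.smul_mulVec, cupCap_mulVec_ket hq, cupCap_mulVec_ket hq, op_op, if_pos rfl, if_pos rfl,
    smul_smul, smul_smul, ← sub_smul, rho_op, ht, ← zpow_neg_one, ← zpow_add₀ hq, ← zpow_add₀ hq]
  convert zero_smul K (cup n q)
  rw [sub_eq_zero]
  congr 1
  ring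

lemma stdR_mul_cupCap {q : K} (hq : q ≠ 0) :
    stdR n q * cupCap n q = q ^ (1 - 2 * (n : ℤ)) • cupCap n q := by
  have := congrArg Matrix.transpose (cupCap_mul_stdR hn ht hq)
  rwa [Matrix.transpose_mul, Matrix.transpose_smul, stdR_transpose, cupCap_transpose] at this

lemma stdR_mul_stdR {q : K} (hq : q ≠ 0) :
    stdR n q * stdR n q = 1 + (q - q⁻¹) • stdR n q
      - ((q - q⁻¹) * q ^ (1 - 2 * (n : ℤ))) • cupCap n q := by
  have hR := stdR_mem (n := n) hq
  refine sub_eq_zero.1 (eq_zero_of_mem_invariants2 hn ht hq (sub_mem (mul_mem hR hR)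
    (sub_mem (add_mem (one_mem _) (Subalgebra.smul_mem _ hR _))
      (Subalgebra.smul_mem _ (cupCap_mem hq) _))) ?_)
  rw [Matrix.sub_mulVec, Matrix.sub_mulVec, Matrix.add_mulVec, ← Matrix.mulVec_mulVec,
    stdR_mulVec_top_op ht hq, Matrix.mulVec_smul, Matrix.smul_mulVec, Matrix.smul_mulVec,
    stdR_mulVec_top_op ht hq, stdR_mulVec_ket hq, cupCap_mulVec_ket hq, op_op,
    if_neg (op_ne_self t), if_pos rfl, if_pos rfl, if_pos rfl, halfCup_top hn ht,
    if_pos (by rw [rho_op]; omega), Matrix.one_mulVec, rho_op, ht]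
  have e : q ^ (1 - 2 * (n : ℤ)) = (q ^ ((n : ℤ) - 1))⁻¹ * (q ^ ((n : ℤ) - 1))⁻¹ * q⁻¹ := by
    rw [← zpow_neg, ← zpow_neg_one, ← zpow_add₀ hq, ← zpow_add₀ hq]
    congr 1
    ring
  have hQ : q ^ ((n : ℤ) - 1) ≠ 0 := zpow_ne_zero _ hq
  rw [e, zpow_neg]
  match_scalars <;> field_simp <;> ring

/-- The value of the loop in terms of the eigenvalue `l` of `R` on the invariant vector. -/
lemma loopValue_eq {q : K} (hq : q ≠ 0) :
    (q - q⁻¹) * q ^ (1 - 2 * (n : ℤ)) * loopValue n q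
      = 1 + (q - q⁻¹) * q ^ (1 - 2 * (n : ℤ)) - (q ^ (1 - 2 * (n : ℤ))) ^ 2 := by
  have h1 := congrArg (· * cupCap n q) (stdR_mul_stdR hn ht hq)
  simp only [mul_assoc, sub_mul, add_mul, smul_mul_assoc, stdR_mul_cupCap hn ht hq,
    cupCap_mul_cupCap hq, mul_smul_comm, one_mul] at h1
  have h2 := congrFun (congrFun h1 (t, op t)) (op t, t)
  simp only [Matrix.smul_apply, Matrix.sub_apply, Matrix.add_apply, smul_eq_mul] at h2
  have h3 : cupCap n q (t, op t) (op t, t) = 1 := by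
    simp [cupCap, rho_op]
  rw [h3] at h2
  linear_combination h2

lemma stdR_bmw {q : K} (hq : q ≠ 0) :
    BMWRelations q (q ^ (1 - 2 * (n : ℤ))) (loopValue n q) (leg12 (stdR n q)) (leg23 (stdR n q))
      (leg12 (cupCap n q)) (leg23 (cupCap n q)) := by
  have R1 := leg12_mem (stdR_mem (n := n) hq)
  have R2 := leg23_mem (stdR_mem (n := n) hq)
  have E1 := leg12_mem (cupCap_mem (n := n) hq)
  have E2 := leg23_mem (cupCap_mem (n := n) hq)
  have hE : ∀ j, cupCap n q *ᵥ ket K t j = (if j = op t then q ^ rho t else 0) • cup n q :=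
    fun j => cupCap_mulVec_ket hq t j
  have gge₁ : leg12 (stdR n q) * leg23 (stdR n q) * leg12 (cupCap n q)
      = leg23 (cupCap n q) * leg12 (cupCap n q) := by
    refine sub_eq_zero.1 (eq_zero_of_mem_invariants3 hn ht hq
      (sub_mem (mul_mem (mul_mem R1 R2) E1) (mul_mem E2 E1)) fun j => ?_)
    simp only [Matrix.sub_mulVec, ← Matrix.mulVec_mulVec, leg12_mulVec_ket3, hE, map_smul,
      Matrix.mulVec_smul]
    rw [leg12_mul_leg23_mulVec_tensR ht hq, leg23_cupCap_mulVec_tensR hq, sub_self]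
  have egg₂ : leg23 (cupCap n q) * leg12 (stdR n q) * leg23 (stdR n q)
      = leg23 (cupCap n q) * leg12 (cupCap n q) := by
    refine sub_eq_zero.1 (eq_zero_of_mem_invariants3 hn ht hq
      (sub_mem (mul_mem (mul_mem E2 R1) R2) (mul_mem E2 E1)) fun j => ?_)
    simp only [Matrix.sub_mulVec, ← Matrix.mulVec_mulVec, leg12_mulVec_ket3, leg23_mulVec_ket3, hE,
      map_smul, Matrix.mulVec_smul, stdR_mulVec_op_top ht hq, tensL_ket, tensR_ket,
      leg23_cupCap_mulVec_tensR hq, smul_smul, ← sub_smul]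
    by_cases h : j = op t
    · simp [h, hq, (op_ne_self t).symm]
    · simp [h]
  constructor
  · have := congrArg (leg12Hom K n) (stdR_mul_stdR hn ht hq)
    simpa only [map_mul, map_add, map_sub, map_smul, map_one, leg12Hom_apply,
      leg23Hom_apply] using this
  · have := congrArg (leg23Hom K n) (stdR_mul_stdR hn ht hq)
    simpa only [map_mul, map_add, map_sub, map_smul, map_one, leg12Hom_apply,
      leg23Hom_apply] using this
  · have := congrArg (leg12Hom K n) (stdR_mul_cupCap hn ht hq)
    simpa only [map_mul, map_smul, leg12Hom_apply, leg23Hom_apply] using this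
  · have := congrArg (leg23Hom K n) (stdR_mul_cupCap hn ht hq)
    simpa only [map_mul, map_smul, leg12Hom_apply, leg23Hom_apply] using this
  · have := congrArg (leg12Hom K n) (cupCap_mul_stdR hn ht hq)
    simpa only [map_mul, map_smul, leg12Hom_apply, leg23Hom_apply] using this
  · have := congrArg (leg23Hom K n) (cupCap_mul_stdR hn ht hq)
    simpa only [map_mul, map_smul, leg12Hom_apply, leg23Hom_apply] using this
  · have := congrArg (leg12Hom K n) (cupCap_mul_cupCap (n := n) hq)
    simpa only [map_mul, map_smul, leg12Hom_apply, leg23Hom_apply] using this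
  · have := congrArg (leg23Hom K n) (cupCap_mul_cupCap (n := n) hq)
    simpa only [map_mul, map_smul, leg12Hom_apply, leg23Hom_apply] using this
  · refine sub_eq_zero.1 (eq_zero_of_mem_invariants3 hn ht hq
      (sub_mem (mul_mem (mul_mem R1 R2) R1) (mul_mem (mul_mem R2 R1) R2)) fun j => ?_)
    simp only [Matrix.sub_mulVec, ← Matrix.mulVec_mulVec, leg12_mulVec_ket3, leg23_mulVec_ket3,
      stdR_mulVec_top_op ht hq, stdR_mulVec_top ht hq, stdR_mulVec_op_top ht hq,
      map_smul, Matrix.mulVec_smul, tensR_ket, tensL_ket, smul_smul, ← sub_smul]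
    convert zero_smul K _
    ring
  · exact gge₁
  · have := congrArg Matrix.transpose egg₂
    simpa only [Matrix.transpose_mul, leg12_transpose, leg23_transpose, stdR_transpose,
      cupCap_transpose, mul_assoc] using this
  · have := congrArg Matrix.transpose gge₁
    simpa only [Matrix.transpose_mul, leg12_transpose, leg23_transpose, stdR_transpose,
      cupCap_transpose, mul_assoc] using this
  · exact egg₂
  · refine sub_eq_zero.1 (eq_zero_of_mem_invariants3 hn ht hq
      (sub_mem (mul_mem (mul_mem E1 E2) E1) E1) fun j => ?_)
    simp only [Matrix.sub_mulVec, ← Matrix.mulVec_mulVec, leg12_mulVec_ket3, hE, map_smul,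
      Matrix.mulVec_smul, leg23_cupCap_mulVec_tensR hq, leg12_cupCap_mulVec_tensL hq, sub_self]
  · refine sub_eq_zero.1 (eq_zero_of_mem_invariants3 hn ht hq
      (sub_mem (mul_mem (mul_mem E2 E1) E2) E2) fun j => ?_)
    simp only [Matrix.sub_mulVec, ← Matrix.mulVec_mulVec, leg23_mulVec_ket3, cupCap_mulVec_ket hq,
      map_smul, Matrix.mulVec_smul, leg23_cupCap_mulVec_tensR hq, leg12_cupCap_mulVec_tensL hq,
      sub_self]

end

end

/-! ### The Yang–Baxter equation in the Birman–Murakami–Wenzl algebra -/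

section

namespace BMWRelations
variable {K : Type*} [Field K] {A : Type*} [Ring A] [Algebra K A] {q l δ : K} {g₁ g₂ e₁ e₂ : A}

lemma symm (H : BMWRelations q l δ g₁ g₂ e₁ e₂) : BMWRelations q l δ g₂ g₁ e₂ e₁ :=
  ⟨H.sq₂, H.sq₁, H.ge₂, H.ge₁, H.eg₂, H.eg₁, H.ee₂, H.ee₁, H.braid.symm, H.gge₂, H.gge₁, H.egg₂,
    H.egg₁, H.eee₂, H.eee₁⟩

lemma map {B : Type*} [Ring B] [Algebra K B] (H : BMWRelations q l δ g₁ g₂ e₁ e₂) (f : A →ₐ[K] B) :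
    BMWRelations q l δ (f g₁) (f g₂) (f e₁) (f e₂) := by
  constructor <;> simp only [← map_mul, ← map_smul, ← map_one f, ← map_add, ← map_sub]
  exacts [congrArg f H.sq₁, congrArg f H.sq₂, congrArg f H.ge₁, congrArg f H.ge₂,
    congrArg f H.eg₁, congrArg f H.eg₂, congrArg f H.ee₁, congrArg f H.ee₂, congrArg f H.braid,
    congrArg f H.gge₁, congrArg f H.gge₂, congrArg f H.egg₁, congrArg f H.egg₂,
    congrArg f H.eee₁, congrArg f H.eee₂]

lemma ege₁ (H : BMWRelations q l δ g₁ g₂ e₁ e₂) (hl : l ≠ 0) : e₁ * g₂ * e₁ = l⁻¹ • e₁ := by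
  have h1 : e₁ * g₂ * g₁ * e₁ = e₁ := by rw [H.egg₁, H.eee₁]
  rw [mul_assoc _ g₁ e₁, H.ge₁, mul_smul_comm] at h1
  conv_rhs => rw [← h1]
  rw [smul_smul, inv_mul_cancel₀ hl, one_smul]

lemma gee₂ (H : BMWRelations q l δ g₁ g₂ e₁ e₂) (hl : l ≠ 0) :
    g₂ * e₁ * e₂ = g₁ * e₂ + (q - q⁻¹) • (e₁ * e₂) - (q - q⁻¹) • e₂ := by
  have h2 := H.gge₂
  rw [mul_assoc] at h2
  have sq := H.sq₂
  generalize q - q⁻¹ = h at sq ⊢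
  rw [mul_assoc]
  nth_rewrite 1 [← h2]
  rw [← mul_assoc, sq]
  simp only [sub_mul, add_mul, one_mul, smul_mul_assoc, ← mul_assoc, H.symm.ege₁ hl, H.gge₂,
    smul_smul]
  rw [mul_assoc, mul_inv_cancel₀ hl, mul_one]

lemma eeg₁ (H : BMWRelations q l δ g₁ g₂ e₁ e₂) (hl : l ≠ 0) :
    e₁ * e₂ * g₁ = e₁ * g₂ + (q - q⁻¹) • (e₁ * e₂) - (q - q⁻¹) • e₁ := by
  rw [← H.egg₁, mul_assoc _ g₁ g₁, H.sq₁]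
  simp only [mul_sub, mul_add, mul_one, mul_smul_comm, H.ege₁ hl, smul_smul]
  rw [mul_assoc _ l, mul_inv_cancel₀ hl, mul_one]

lemma geg (H : BMWRelations q l δ g₁ g₂ e₁ e₂) (hl : l ≠ 0) :
    g₁ * e₂ * g₁ = g₂ * e₁ * g₂ - (q - q⁻¹) • (g₂ * e₁) - (q - q⁻¹) • (e₁ * g₂)
      + (q - q⁻¹) • (g₁ * e₂) + (q - q⁻¹) • (e₂ * g₁)
      + ((q - q⁻¹) * (q - q⁻¹)) • e₁ - ((q - q⁻¹) * (q - q⁻¹)) • e₂ := by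
  have h1 : g₁ * e₂ = g₂ * e₁ * e₂ - (q - q⁻¹) • (e₁ * e₂) + (q - q⁻¹) • e₂ := by
    rw [H.gee₂ hl]; abel
  rw [h1]
  simp only [sub_mul, add_mul, smul_mul_assoc]
  rw [mul_assoc g₂ e₁ e₂, mul_assoc g₂, H.eeg₁ hl]
  simp only [mul_sub, mul_add, mul_smul_comm, ← mul_assoc, H.gee₂ hl]
  module

/-- The Yang–Baxterization of a Birman–Murakami–Wenzl generator, with its denominators cleared. -/
def baxter (q l z : K) (g e : A) : A :=
  (q * z - l⁻¹) • ((z - 1) • g - ((q - q⁻¹) * z) • (1 : A)) + (q * (q - q⁻¹) * z * (z - 1)) • e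

lemma baxter_eq (q l z : K) (g e : A) : baxter q l z g e =
    ((q * z - l⁻¹) * (z - 1)) • g + (-((q * z - l⁻¹) * ((q - q⁻¹) * z))) • (1 : A)
      + (q * (q - q⁻¹) * z * (z - 1)) • e := by
  rw [baxter]; module

set_option maxHeartbeats 400000 in
/-- The Yang–Baxter equation holds for the Yang–Baxterization of any representation of the
Birman–Murakami–Wenzl algebra. Both sides are expanded and reduced to a basis of the algebra. -/
theorem yang_baxter (H : BMWRelations q l δ g₁ g₂ e₁ e₂) (hq : q ≠ 0) (hl : l ≠ 0)
    (hδ : (q - q⁻¹) * l * δ = 1 + (q - q⁻¹) * l - l ^ 2) (z w : K) :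
    baxter q l z g₁ e₁ * baxter q l (z * w) g₂ e₂ * baxter q l w g₁ e₁
      = baxter q l w g₂ e₂ * baxter q l (z * w) g₁ e₁ * baxter q l z g₂ e₂ := by
  have hC : ∀ x y : K, q * (q - q⁻¹) * x * (x - 1) * (q * (q - q⁻¹) * y * (y - 1)) * δ
      = q * x * (x - 1) * (q * (q - q⁻¹) * y * (y - 1)) * (l⁻¹ + (q - q⁻¹) - l) := by
    intro x y
    have : (q - q⁻¹) * δ = l⁻¹ + (q - q⁻¹) - l := by
      field_simp at hδ ⊢; linear_combination hδ
    linear_combination q * x * (x - 1) * (q * (q - q⁻¹) * y * (y - 1)) * this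
  simp only [baxter_eq]
  generalize hA1 : (q * z - l⁻¹) * (z - 1) = a1
  generalize hA2 : (q * (z * w) - l⁻¹) * (z * w - 1) = a2
  generalize hA3 : (q * w - l⁻¹) * (w - 1) = a3
  generalize hB1 : -((q * z - l⁻¹) * ((q - q⁻¹) * z)) = b1
  generalize hB2 : -((q * (z * w) - l⁻¹) * ((q - q⁻¹) * (z * w))) = b2
  generalize hB3 : -((q * w - l⁻¹) * ((q - q⁻¹) * w)) = b3
  generalize hC1 : q * (q - q⁻¹) * z * (z - 1) = c1
  generalize hC2 : q * (q - q⁻¹) * (z * w) * (z * w - 1) = c2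
  generalize hC3 : q * (q - q⁻¹) * w * (w - 1) = c3
  have hcδ := hC z w
  rw [hC1, hC3] at hcδ
  simp only [mul_add, add_mul, smul_mul_assoc, mul_smul_comm, one_mul, mul_one, smul_smul,
    H.sq₁, H.sq₂, H.ge₁, H.ge₂, H.eg₁, H.eg₂, H.ee₁, H.ee₂, H.braid, H.gge₁, H.gge₂, H.egg₁, H.egg₂,
    H.eee₁, H.eee₂, H.ege₁ hl, H.symm.ege₁ hl, H.gee₂ hl, H.symm.gee₂ hl, H.eeg₁ hl, H.symm.eeg₁ hl,
    H.geg hl]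
  match_scalars
  -- Only the coefficients of `e₁` and `e₂` involve `δ`.
  on_goal 6 => linear_combination (norm := ring_nf) b2 * hcδ
  on_goal 12 => linear_combination (norm := ring_nf) (-b2) * hcδ
  all_goals subst hA1 hA2 hA3 hB1 hB2 hB3 hC1 hC2 hC3; clear hcδ hC hδ
  all_goals field_simp
  all_goals ring1

end BMWRelations

end

/-! ### Skein consequences, diagonal twists and matrix entries -/

section

section Skein
variable {K : Type*} [Field K] {A : Type*} [Ring A] [Algebra K A] {q l δ : K} {g e : A}

lemma mul_inverse_of_skein (hsq : g * g = 1 + (q - q⁻¹) • g - ((q - q⁻¹) * l) • e)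
    (hge : g * e = l • e) : g * (g - (q - q⁻¹) • (1 : A) + (q - q⁻¹) • e) = 1 := by
  rw [mul_add, mul_sub, hsq, mul_smul_comm, mul_smul_comm, hge, mul_one]
  module

lemma cubic_of_skein (hq : q ≠ 0) (hsq : g * g = 1 + (q - q⁻¹) • g - ((q - q⁻¹) * l) • e)
    (heg : e * g = l • e) : (g - q • (1 : A)) * (g - (-q⁻¹) • (1 : A)) * (g - l • (1 : A)) = 0 := by
  have h1 : (g - q • (1 : A)) * (g - (-q⁻¹) • (1 : A)) = (-((q - q⁻¹) * l)) • e := by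
    simp only [sub_mul, mul_sub, smul_mul_assoc, mul_smul_comm, one_mul, mul_one, hsq]
    match_scalars <;> field_simp <;> ring1
  rw [h1, smul_mul_assoc, mul_sub, heg, mul_smul_comm, mul_one, sub_self, smul_zero]

/-- Unitarity of the Yang–Baxterization, up to a scalar. -/
lemma baxter_mul_baxter_inv (hq : q ≠ 0) (hl : l ≠ 0)
    (hsq : g * g = 1 + (q - q⁻¹) • g - ((q - q⁻¹) * l) • e)
    (hge : g * e = l • e) (heg : e * g = l • e) (hee : e * e = δ • e)
    (hδ : (q - q⁻¹) * l * δ = 1 + (q - q⁻¹) * l - l ^ 2) {z : K} (hz : z ≠ 0) :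
    BMWRelations.baxter q l z g e * BMWRelations.baxter q l z⁻¹ g e =
      (((q * z - l⁻¹) * (z - q ^ 2) * q⁻¹) * ((q * z⁻¹ - l⁻¹) * (z⁻¹ - q ^ 2) * q⁻¹)) •
        (1 : A) := by
  simp only [BMWRelations.baxter_eq, mul_add, add_mul, smul_mul_assoc, mul_smul_comm, one_mul,
    mul_one, smul_smul, hsq, hge, heg, hee]
  have h1 : (q - q⁻¹) * δ = l⁻¹ + (q - q⁻¹) - l := by
    field_simp at hδ ⊢; linear_combination hδ
  match_scalars
  on_goal 3 =>
    linear_combination (norm := ring_nf)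
      (q * z * (z - 1) * (q * (q - q⁻¹) * z⁻¹ * (z⁻¹ - 1))) * h1
  all_goals field_simp
  all_goals ring1

end Skein

section Twist
variable {K : Type*} [Field K] {X : Type*} [Fintype X] [DecidableEq X]

/-- Relabelling the basis by `σ` and conjugating by the diagonal matrix with entries `φ`. -/
def twistHom (σ : X ≃ X) (φ : X → K) (hφ : ∀ x, φ x ≠ 0) : Matrix X X K →ₐ[K] Matrix X X K :=
  AlgHom.ofLinearMap
    { toFun := fun A => Matrix.of fun x y => φ (σ x) * A (σ x) (σ y) * (φ (σ y))⁻¹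
      map_add' := fun A B => by ext x y; simp; ring
      map_smul' := fun c A => by ext x y; simp; ring }
    (by
      ext x y
      by_cases h : x = y
      · subst h; simp [hφ]
      · simp [h, Matrix.one_apply])
    (fun A B => by
      ext x y
      simp only [LinearMap.coe_mk, AddHom.coe_mk, Matrix.of_apply, Matrix.mul_apply]
      rw [Finset.mul_sum, Finset.sum_mul, ← Equiv.sum_comp σ]
      refine Finset.sum_congr rfl fun z _ => ?_
      have := hφ (σ z)
      field_simp)

lemma twistHom_apply (σ : X ≃ X) (φ : X → K) (hφ : ∀ x, φ x ≠ 0) (A : Matrix X X K) (x y : X) :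
    twistHom σ φ hφ A x y = φ (σ x) * A (σ x) (σ y) * (φ (σ y))⁻¹ := rfl

end Twist

section Brace
variable {K : Type*} [Field K] {n : ℕ}

lemma EE_apply (i j k l x y u v : Fin (2 * n)) :
    EE K i j k l (x, y) (u, v) = if i = x ∧ j = u ∧ k = y ∧ l = v then 1 else 0 := by
  rw [EE, Matrix.kronecker_apply, Matrix.single_apply, Matrix.single_apply]
  by_cases h1 : i = x <;> by_cases h2 : j = u <;> by_cases h3 : k = y <;> by_cases h4 : l = v <;>
    simp [h1, h2, h3, h4]

/-- The number of times that the pair `(x, y)` occurs in the summation range of `braceSum`. -/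
def braceCount (K : Type*) [Field K] (x y : Fin (2 * n)) : K :=
  if ((x : ℕ) < n ↔ (y : ℕ) < n) ∧ min (x : ℕ) (2 * n - 1 - x) < min (y : ℕ) (2 * n - 1 - y) ∨
    ¬ ((x : ℕ) < n ↔ (y : ℕ) < n) ∧ min (y : ℕ) (2 * n - 1 - y) < min (x : ℕ) (2 * n - 1 - x)
  then 1 else 0

lemma sumOver_EE (c : ℕ → ℕ → Prop) [∀ i j, Decidable (c i j)] (x y u v : Fin (2 * n)) :
    sumOver c (fun i j => EE K i j j i) (x, y) (u, v) =
      if u = y ∧ v = x then (if c (pos x) (pos y) then 1 else 0) else 0 := by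
  simp only [sumOver, Matrix.sum_apply]
  rw [Finset.sum_eq_single x, Finset.sum_eq_single y]
  · by_cases h1 : c (pos x) (pos y) <;> simp [h1, EE_apply, eq_comm]
  · intro j _ hj
    split_ifs <;> simp [EE_apply, hj]
  · simp
  · intro i _ hi
    refine Finset.sum_eq_zero fun j _ => ?_
    split_ifs <;> simp [EE_apply, hi]
  · simp

lemma sumOver_EE_swap (c : ℕ → ℕ → Prop) [∀ i j, Decidable (c i j)] (x y u v : Fin (2 * n)) :
    sumOver c (fun i j => EE K j i i j) (x, y) (u, v) =
      if u = y ∧ v = x then (if c (pos y) (pos x) then 1 else 0) else 0 := by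
  simp only [sumOver, Matrix.sum_apply]
  rw [Finset.sum_eq_single y, Finset.sum_eq_single x]
  · by_cases h1 : c (pos y) (pos x) <;> simp [h1, EE_apply, eq_comm]
  · intro j _ hj
    split_ifs <;> simp [EE_apply, hj]
  · simp
  · intro i _ hi
    refine Finset.sum_eq_zero fun j _ => ?_
    split_ifs <;> simp [EE_apply, hi]
  · simp

/-- The five summation ranges are disjoint, and their union is described by `braceCount`. -/
lemma braceCount_eq (x y : Fin (2 * n)) : braceCount K x y =
    (if (1 ≤ pos x ∧ pos x ≤ n - 1) ∧ (pos x + 1 ≤ pos y ∧ pos y ≤ n) then 1 else 0)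
    + (if (1 ≤ pos x ∧ pos x ≤ n - 1) ∧ ((2 * n + 1 - pos x) + 1 ≤ pos y ∧ pos y ≤ 2 * n)
        then 1 else 0)
    + (if pos x = n ∧ (n + 2 ≤ pos y ∧ pos y ≤ 2 * n) then 1 else 0)
    + (if (n + 1 ≤ pos y ∧ pos y ≤ 2 * n - 1) ∧ (pos y + 1 ≤ pos x ∧ pos x ≤ 2 * n)
        then 1 else 0)
    + (if (1 ≤ pos y ∧ pos y ≤ n - 1) ∧ (n + 1 ≤ pos x ∧ pos x ≤ 2 * n - pos y)
        then 1 else 0) := by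
  have hx := x.isLt
  have hy := y.isLt
  have hpx : pos x = (x : ℕ) + 1 := rfl
  have hpy : pos y = (y : ℕ) + 1 := rfl
  generalize pos x = i at hpx ⊢
  generalize pos y = j at hpy ⊢
  simp only [braceCount]
  by_cases h1 : (x : ℕ) < n <;> by_cases h2 : (y : ℕ) < n <;> simp only [h1, h2, iff_true,
    not_true, not_false_iff, iff_false, true_and, false_and, or_false, false_or] <;>
    repeat' split
  all_goals first | omega | simp only [add_zero, zero_add]

lemma braceSum_apply (x y u v : Fin (2 * n)) :
    braceSum (fun i j => EE K i j j i) (x, y) (u, v) =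
      if u = y ∧ v = x then braceCount K x y else 0 := by
  simp only [braceSum, Matrix.add_apply, sumOver_EE, sumOver_EE_swap, braceCount_eq]
  by_cases h : u = y ∧ v = x
  · simp only [h, and_self, if_true]
  · simp only [h, if_false, add_zero]

lemma braceSum_swap_apply (x y u v : Fin (2 * n)) :
    braceSum (fun i j => EE K j i i j) (x, y) (u, v) =
      if u = y ∧ v = x then braceCount K y x else 0 := by
  simp only [braceSum, Matrix.add_apply, sumOver_EE, sumOver_EE_swap, braceCount_eq]
  by_cases h : u = y ∧ v = x
  · simp only [h, and_self, if_true]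
  · simp only [h, if_false, add_zero]

end Brace

end

/-! ### The two-parameter matrix as a twist -/

section

variable {K : Type*} [Field K] {n : ℕ}

/-- The diagonal twist relating `basicR` to `stdR`: a bicharacter on the weights `±ε_i` of `V`. -/
def twistWeight (c : K) (x y : Fin (2 * n)) : K :=
  if min (x : ℕ) (2 * n - 1 - x) < min (y : ℕ) (2 * n - 1 - y) then
    (if (x : ℕ) < n ↔ (y : ℕ) < n then c⁻¹ else c) else 1

lemma twistWeight_ne_zero {c : K} (hc : c ≠ 0) (x y : Fin (2 * n)) : twistWeight c x y ≠ 0 := by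
  unfold twistWeight
  split_ifs <;> simp [hc]

lemma min_op (x : Fin (2 * n)) :
    min ((op x : Fin (2 * n)) : ℕ) (2 * n - 1 - (op x : Fin (2 * n)))
      = min (x : ℕ) (2 * n - 1 - x) := by
  have := x.isLt
  rw [Fin.val_rev]; omega

lemma op_lt_iff (x : Fin (2 * n)) : ((op x : Fin (2 * n)) : ℕ) < n ↔ ¬ (x : ℕ) < n := by
  have := x.isLt
  rw [Fin.val_rev]; omega

lemma twistWeight_op (c : K) (x : Fin (2 * n)) : twistWeight c x (op x) = 1 := by
  rw [twistWeight, min_op, if_neg (lt_irrefl _)]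

/-- Opposite weights contribute inverse factors. -/
lemma twistWeight_mul_op {c : K} (hc : c ≠ 0) (x m : Fin (2 * n)) :
    twistWeight c x m * twistWeight c (op x) m = 1 := by
  simp only [twistWeight, min_op, op_lt_iff]
  generalize min (x : ℕ) (2 * n - 1 - x) = i
  generalize min (m : ℕ) (2 * n - 1 - m) = j
  by_cases h1 : (x : ℕ) < n <;> by_cases h2 : (m : ℕ) < n <;> by_cases h : i < j <;>
    simp [h1, h2, h, hc]

/-- The analogue of `twistWeight_mul_op` in the second argument. -/
lemma twistWeight_mul_op' {c : K} (hc : c ≠ 0) (m x : Fin (2 * n)) :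
    twistWeight c m x * twistWeight c m (op x) = 1 := by
  simp only [twistWeight, min_op, op_lt_iff]
  generalize min (x : ℕ) (2 * n - 1 - x) = i
  generalize min (m : ℕ) (2 * n - 1 - m) = j
  by_cases h1 : (x : ℕ) < n <;> by_cases h2 : (m : ℕ) < n <;> by_cases h : j < i <;>
    simp [h1, h2, h, hc]

lemma braceCount_self (x : Fin (2 * n)) : braceCount K x x = 0 := by
  simp [braceCount]

lemma braceCount_op (x : Fin (2 * n)) : braceCount K x (op x) = 0 := by
  rw [braceCount, min_op, if_neg]
  simp

lemma braceCount_op' (x : Fin (2 * n)) : braceCount K (op x) x = 0 := by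
  rw [braceCount, min_op, if_neg]
  simp

/-- For non-opposite indices the twists in the two orders have the ratio `c⁻¹` or `c`, according to
the sum in `basicR` to which the pair contributes. -/
lemma twistWeight_eq {c : K} (hc : c ≠ 0) {x y : Fin (2 * n)} (h1 : y ≠ x) (h2 : y ≠ op x) :
    twistWeight c x y = (c⁻¹ * braceCount K x y + c * braceCount K y x) * twistWeight c y x := by
  have hx := x.isLt
  have hy := y.isLt
  have h3 : min (x : ℕ) (2 * n - 1 - x) ≠ min (y : ℕ) (2 * n - 1 - y) := by
    rw [Ne, Fin.ext_iff] at h1 h2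
    rw [Fin.val_rev] at h2
    omega
  simp only [braceCount, twistWeight]
  generalize min (x : ℕ) (2 * n - 1 - x) = i at h3 ⊢
  generalize min (y : ℕ) (2 * n - 1 - y) = j at h3 ⊢
  rcases lt_or_gt_of_ne h3 with h | h <;>
    by_cases k1 : (x : ℕ) < n <;> by_cases k2 : (y : ℕ) < n <;>
    simp [h, not_lt_of_gt h, k1, k2, hc]

/-- The entries of `basicR`. -/
lemma basicR_apply (a b : K) (x y u v : Fin (2 * n)) :
    basicR n a b (x, y) (u, v) =
      (if u = x ∧ y = x ∧ v = x then a⁻¹ * b else 0)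
      + (if y = op x ∧ u = op x ∧ v = x then a * b⁻¹ else 0)
      + (if u = y ∧ v = x then a⁻¹ * b⁻¹ * braceCount K x y + a * b * braceCount K y x else 0)
      + (if x = u ∧ y = v ∧ y < x then a⁻¹ * b - a * b⁻¹ else 0)
      - (if (y = op x ∧ v = op u) ∧ v < x then
          (a⁻¹ * b - a * b⁻¹) * (a⁻¹ * b) ^ (rho x + rho u) else 0) := by
  have s1 : (∑ i, EE K i i i i) (x, y) (u, v) = if u = x ∧ y = x ∧ v = x then 1 else 0 := by
    rw [Matrix.sum_apply, Finset.sum_eq_single x]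
    · simp [EE_apply, eq_comm]
    · intro i _ hi; simp [EE_apply, hi]
    · simp
  have s2 : (∑ i, EE K i (op i) (op i) i) (x, y) (u, v) =
      if y = op x ∧ u = op x ∧ v = x then 1 else 0 := by
    rw [Matrix.sum_apply, Finset.sum_eq_single x]
    · rw [EE_apply]
      refine if_congr ?_ rfl rfl
      constructor
      · rintro ⟨-, h1, h2, h3⟩; exact ⟨h2.symm, h1.symm, h3.symm⟩
      · rintro ⟨h1, h2, h3⟩; exact ⟨rfl, h2.symm, h1.symm, h3.symm⟩
    · intro i _ hi; simp [EE_apply, hi]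
    · simp
  have s3 : (∑ i, ∑ j, if i < j then EE K j j i i else 0) (x, y) (u, v) =
      if x = u ∧ y = v ∧ y < x then 1 else 0 := by
    simp only [Matrix.sum_apply]
    rw [Finset.sum_eq_single y, Finset.sum_eq_single x]
    · by_cases h : y < x <;> simp [h, EE_apply]
    · intro j _ hj
      split_ifs <;> simp [EE_apply, hj]
    · simp
    · intro i _ hi
      refine Finset.sum_eq_zero fun j _ => ?_
      split_ifs <;> simp [EE_apply, hi]
    · simp
  have s4 : (∑ i, ∑ j, if i > j then ((a⁻¹ * b) ^ (rho i - rho j)) • EE K i (op j) (op i) j else 0)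
      (x, y) (u, v) = if (y = op x ∧ v = op u) ∧ v < x then (a⁻¹ * b) ^ (rho x + rho u) else 0 := by
    simp only [Matrix.sum_apply]
    rw [Finset.sum_eq_single x, Finset.sum_eq_single v]
    · have e : op x = y ↔ y = op x := eq_comm
      have e' : op v = u ↔ v = op u := by rw [eq_comm]; exact eq_op_comm
      by_cases h : v < x
      · rw [if_pos (show x > v from h), Matrix.smul_apply, EE_apply, smul_eq_mul, mul_ite, mul_one,
          mul_zero]
        refine (if_congr ?_ rfl rfl).trans (ite_congr rfl (fun h' => ?_) fun _ => rfl)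
        · simp only [e, e', true_and, h, and_true]; tauto
        · rw [h'.1.2, rho_op, sub_neg_eq_add]
      · rw [if_neg (show ¬ x > v from h), if_neg (fun h' => h h'.2), Matrix.zero_apply]
    · intro j _ hj
      split_ifs <;> simp [EE_apply, hj]
    · simp
    · intro i _ hi
      refine Finset.sum_eq_zero fun j _ => ?_
      split_ifs <;> simp [EE_apply, hi]
    · simp
  simp only [basicR, Matrix.add_apply, Matrix.sub_apply, Matrix.smul_apply, s1, s2, s3, s4,
    braceSum_apply, braceSum_swap_apply, smul_eq_mul]
  by_cases h : u = y ∧ v = x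
  · simp only [h, and_self, if_true, mul_ite, mul_one, mul_zero, mul_sub]
    ring
  · simp only [h, if_false, mul_ite, mul_one, mul_zero, mul_sub, add_zero]
    ring

/-- `basicR` is the twist of the one-parameter matrix. The condition `i < j` in `basicR` and the
condition `ρ_j < ρ_i` in `stdR` differ only for the pair `n`, `n'`, where the corresponding summands
of the two sums in braces cancel. -/
lemma basicR_eq_twist {a b : K} (ha : a ≠ 0) (hb : b ≠ 0) (x y u v : Fin (2 * n)) :
    basicR n a b (x, y) (u, v) =
      twistWeight (a * b) x y * stdR n (a⁻¹ * b) (x, y) (u, v) * (twistWeight (a * b) u v)⁻¹ := by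
  have hab : a * b ≠ 0 := mul_ne_zero ha hb
  have hq : (a⁻¹ * b)⁻¹ = a * b⁻¹ := by rw [mul_inv, inv_inv]
  have hc : a⁻¹ * b⁻¹ = (a * b)⁻¹ := by rw [mul_inv]
  rw [basicR_apply, stdR]
  simp only [Matrix.of_apply, Prod.mk.injEq, hq]
  generalize hh : a⁻¹ * b - a * b⁻¹ = h
  by_cases hyx : y = op x
  · subst hyx
    rw [twistWeight_op, one_mul]
    by_cases hvu : v = op u
    · subst hvu
      rw [twistWeight_op, inv_one, mul_one]
      have e1 : op u = x ↔ u = op x := by rw [eq_comm]; exact eq_op_comm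
      have e2 : x = op u ↔ u = op x := eq_op_comm
      have e3 : op x = op u ↔ x = u := Fin.rev_inj
      have e4 : op x = u ↔ u = op x := eq_comm
      simp only [e1, e2, e3, e4, braceCount_op, braceCount_op', mul_zero, add_zero, true_and,
        and_self, (op_ne_self _), (op_ne_self _).symm, false_and, and_false, if_false, zero_add,
        ite_self]
      by_cases hxu : x = u
      · subst hxu
        have e5 : op x < x ↔ (rho x < rho (op x) ∨ rho x = 0 ∧ op x < x) := by
          have := x.isLt
          simp only [rho, pos, Fin.lt_def, Fin.val_rev]
          split_ifs <;> omega
        by_cases h0 : rho x = 0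
        · simp [h0]
        · have h2 : op x < x ↔ rho x < rho (op x) := by rw [e5]; simp [h0]
          simp [h2]
      · have hlt : op u < x ↔ rho x < rho (op u) :=
          lt_iff_rho_lt (by rw [op_op]; exact hxu)
        simp only [hxu, false_and, if_false, hlt]
        simp
    · have h1 : ¬ (u = op x ∧ v = x) := by
        rintro ⟨rfl, rfl⟩; exact hvu (op_op _).symm
      have h2 : ¬ (x = u ∧ op x = v) := by
        rintro ⟨rfl, rfl⟩; exact hvu rfl
      have h3 : ¬ (x = v ∧ op x = u) := fun h => h1 ⟨h.2.symm, h.1.symm⟩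
      have h4 : ¬ (x = u ∧ op x = v ∧ op x < x) := fun h => h2 ⟨h.1, h.2.1⟩
      have h5 : ¬ (u = x ∧ op x = x ∧ v = x) := fun h => op_ne_self _ h.2.1
      simp [h1, h2, h3, h4, h5, hvu]
  · have hz : ∀ t : K, (if (y = op x ∧ v = op u) ∧ v < x then t else 0) = 0 := fun t =>
      if_neg fun h => hyx h.1.1
    have hz' : ∀ t : K, (if (y = op x ∧ v = op u) ∧ rho x < rho v then t else 0) = 0 := fun t =>
      if_neg fun h => hyx h.1.1
    rw [hz, hz', sub_zero, sub_zero, if_neg (fun h => hyx h.1 : ¬ (y = op x ∧ u = op x ∧ v = x)),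
      add_zero]
    by_cases hsw : x = v ∧ y = u
    · obtain ⟨rfl, rfl⟩ := hsw
      by_cases hxy : y = x
      · subst hxy
        have ht := twistWeight_ne_zero hab y y
        simp [braceCount_self]
        field_simp
      · have h1 : ¬ (x = y) := fun h => hxy h.symm
        have h2 : ¬ (x = op y) := fun h => hyx (eq_op_comm.1 h)
        have ht := twistWeight_ne_zero hab y x
        simp only [hxy, h1, h2, false_and, if_false, and_self, if_true, zero_add, add_zero,
          mul_one, hc]
        rw [twistWeight_eq hab hxy hyx]
        field_simp
    · have hsw' : ¬ (u = y ∧ v = x) := fun h => hsw ⟨h.2.symm, h.1.symm⟩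
      have h1 : ¬ (u = x ∧ y = x ∧ v = x) := by
        rintro ⟨rfl, rfl, rfl⟩; exact hsw ⟨rfl, rfl⟩
      rw [if_neg hsw, if_neg hsw', if_neg h1]
      by_cases hd : x = u ∧ y = v
      · obtain ⟨rfl, rfl⟩ := hd
        have h2 : y < x ↔ rho x < rho y :=
          lt_iff_rho_lt fun h => hyx (eq_op_comm.1 h)
        have ht := twistWeight_ne_zero hab x y
        simp only [h2, true_and, and_self]
        field_simp
        simp
      · have hd' : ¬ (x = u ∧ y = v ∧ y < x) := fun h => hd ⟨h.1, h.2.1⟩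
        simp [hd, hd']

end

/-! ### Transport of the relations to two parameters -/

section

variable {K : Type*} [Field K] {n : ℕ}

lemma flip_apply (x y u v : Fin (2 * n)) :
    flip K n (x, y) (u, v) = if u = y ∧ v = x then 1 else 0 := by
  simp only [flip, Matrix.sum_apply]
  rw [Finset.sum_eq_single x, Finset.sum_eq_single y]
  · simp [EE_apply, eq_comm]
  · intro j _ hj; simp [EE_apply, hj]
  · simp
  · intro i _ hi
    exact Finset.sum_eq_zero fun j _ => by simp [EE_apply, hi]
  · simp

lemma flip_mul_apply (A : Op2 K n) (x y : Fin (2 * n)) (w) :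
    (flip K n * A) (x, y) w = A (y, x) w := by
  rw [Matrix.mul_apply, Finset.sum_eq_single (y, x)]
  · simp [flip_apply]
  · rintro ⟨u, v⟩ _ h
    rw [flip_apply, if_neg, zero_mul]
    rintro ⟨rfl, rfl⟩; exact h rfl
  · simp

lemma mul_flip_apply (A : Op2 K n) (w) (x y : Fin (2 * n)) :
    (A * flip K n) w (x, y) = A w (y, x) := by
  rw [Matrix.mul_apply, Finset.sum_eq_single (y, x)]
  · simp [flip_apply]
  · rintro ⟨u, v⟩ _ h
    rw [flip_apply, if_neg, mul_zero]
    rintro ⟨rfl, rfl⟩; exact h rfl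
  · simp

lemma leg21_apply (A : Op2 K n) (x y u v : Fin (2 * n)) :
    leg21 A (x, y) (u, v) = A (y, x) (v, u) := by
  rw [leg21, mul_flip_apply, flip_mul_apply]

lemma flip_mul_flip : flip K n * flip K n = 1 := by
  ext ⟨x, y⟩ ⟨u, v⟩
  rw [flip_mul_apply, flip_apply, Matrix.one_apply]
  simp [eq_comm]

/-- The diagonal twist of `V ⊗ V` given by a function of the two indices. -/
def twist2 (c : K) (hc : c ≠ 0) : Op2 K n →ₐ[K] Op2 K n :=
  twistHom (Equiv.refl _) (fun x => twistWeight c x.1 x.2) fun _ => twistWeight_ne_zero hc _ _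

lemma twist2_apply {c : K} (hc : c ≠ 0) (A : Op2 K n) (x y u v : Fin (2 * n)) :
    twist2 c hc A (x, y) (u, v) =
      twistWeight c x y * A (x, y) (u, v) * (twistWeight c u v)⁻¹ := rfl

/-- The diagonal twist of `V ⊗ V ⊗ V` that restricts to `twist2` on adjacent factors. -/
def twist3 (c : K) (hc : c ≠ 0) : Op3 K n →ₐ[K] Op3 K n :=
  twistHom (Equiv.refl _)
    (fun x => twistWeight c x.1 x.2.1 * twistWeight c x.1 x.2.2 * twistWeight c x.2.1 x.2.2)
    fun _ => mul_ne_zero (mul_ne_zero (twistWeight_ne_zero hc _ _) (twistWeight_ne_zero hc _ _))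
      (twistWeight_ne_zero hc _ _)

lemma twist3_apply {c : K} (hc : c ≠ 0) (A : Op3 K n)
    (x y : Fin (2 * n) × Fin (2 * n) × Fin (2 * n)) :
    twist3 c hc A x y =
      (twistWeight c x.1 x.2.1 * twistWeight c x.1 x.2.2 * twistWeight c x.2.1 x.2.2) * A x y *
      (twistWeight c y.1 y.2.1 * twistWeight c y.1 y.2.2 * twistWeight c y.2.1 y.2.2)⁻¹ := rfl

/-- The operator preserves the weights of `V ⊗ V`. -/
def PreservesWeight (A : Op2 K n) : Prop :=
  ∀ x y u v, A (x, y) (u, v) ≠ 0 → (x = u ∧ y = v) ∨ (x = v ∧ y = u) ∨ (y = op x ∧ v = op u)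

lemma stdR_preservesWeight (q : K) : PreservesWeight (stdR n q) := by
  intro x y u v h
  contrapose! h
  obtain ⟨h1, h2, h3⟩ := h
  have h1' : ¬ (x = u ∧ y = v) := fun h => h1 h.1 h.2
  have h2' : ¬ (x = v ∧ y = u) := fun h => h2 h.1 h.2
  have h3' : ¬ (y = op x ∧ v = op u) := fun h => h3 h.1 h.2
  simp [stdR, h1', h2', h3']

lemma cupCap_preservesWeight (q : K) : PreservesWeight (cupCap n q) := by
  intro x y u v h
  contrapose! h
  have h3' : ¬ (y = op x ∧ v = op u) := fun h' => h.2.2 h'.1 h'.2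
  simp [cupCap, h3']

lemma PreservesWeight.weight_left {A : Op2 K n} (hA : PreservesWeight A) {c : K} (hc : c ≠ 0)
    {x y u v : Fin (2 * n)} (h : A (x, y) (u, v) ≠ 0) (m : Fin (2 * n)) :
    twistWeight c x m * twistWeight c y m = twistWeight c u m * twistWeight c v m := by
  rcases hA x y u v h with ⟨rfl, rfl⟩ | ⟨rfl, rfl⟩ | ⟨rfl, rfl⟩
  · rfl
  · rw [mul_comm]
  · rw [twistWeight_mul_op hc, twistWeight_mul_op hc]

lemma PreservesWeight.weight_right {A : Op2 K n} (hA : PreservesWeight A) {c : K} (hc : c ≠ 0)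
    {x y u v : Fin (2 * n)} (h : A (x, y) (u, v) ≠ 0) (m : Fin (2 * n)) :
    twistWeight c m x * twistWeight c m y = twistWeight c m u * twistWeight c m v := by
  rcases hA x y u v h with ⟨rfl, rfl⟩ | ⟨rfl, rfl⟩ | ⟨rfl, rfl⟩
  · rfl
  · rw [mul_comm]
  · rw [twistWeight_mul_op' hc, twistWeight_mul_op' hc]

lemma PreservesWeight.leg12_twist2 {A : Op2 K n} (hA : PreservesWeight A) {c : K} (hc : c ≠ 0) :
    leg12 (twist2 c hc A) = twist3 c hc (leg12 A) := by
  ext ⟨x, y, m⟩ ⟨u, v, m'⟩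
  simp only [twist3_apply, leg12, Matrix.of_apply, twist2_apply]
  by_cases hm : m = m'
  · subst hm
    rw [if_pos rfl, if_pos rfl]
    by_cases h : A (x, y) (u, v) = 0
    · simp [h]
    · rw [mul_assoc (twistWeight c x y) (twistWeight c x m),
        mul_assoc (twistWeight c u v) (twistWeight c u m), hA.weight_left hc h]
      have := twistWeight_ne_zero hc u m
      have := twistWeight_ne_zero hc v m
      field_simp
  · simp [hm]

lemma PreservesWeight.leg23_twist2 {A : Op2 K n} (hA : PreservesWeight A) {c : K} (hc : c ≠ 0) :
    leg23 (twist2 c hc A) = twist3 c hc (leg23 A) := by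
  ext ⟨m, x, y⟩ ⟨m', u, v⟩
  simp only [twist3_apply, leg23, Matrix.of_apply, twist2_apply]
  by_cases hm : m = m'
  · subst hm
    rw [if_pos rfl, if_pos rfl]
    by_cases h : A (x, y) (u, v) = 0
    · simp [h]
    · rw [hA.weight_right hc h]
      have := twistWeight_ne_zero hc m u
      have := twistWeight_ne_zero hc m v
      field_simp
  · simp [hm]

lemma twist2_stdR {a b : K} (ha : a ≠ 0) (hb : b ≠ 0) :
    twist2 (a * b) (mul_ne_zero ha hb) (stdR n (a⁻¹ * b)) = basicR n a b := by
  ext ⟨x, y⟩ ⟨u, v⟩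
  rw [basicR_eq_twist ha hb, twist2_apply]

lemma twist2_cupCap {c : K} (hc : c ≠ 0) (q : K) : twist2 c hc (cupCap n q) = cupCap n q := by
  ext ⟨x, y⟩ ⟨u, v⟩
  rw [twist2_apply]
  by_cases h : y = op x ∧ v = op u
  · obtain ⟨rfl, rfl⟩ := h
    rw [twistWeight_op, twistWeight_op, one_mul, inv_one, mul_one]
  · simp [cupCap, h]

/-- Reversal of the order of the three tensor factors. -/
def rev3 (K : Type*) [Field K] (n : ℕ) : Op3 K n →ₐ[K] Op3 K n :=
  twistHom ⟨fun x => (x.2.2, x.2.1, x.1), fun x => (x.2.2, x.2.1, x.1), fun _ => rfl, fun _ => rfl⟩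
    (fun _ => 1) fun _ => one_ne_zero

lemma leg12_leg21 (A : Op2 K n) : leg12 (leg21 A) = rev3 K n (leg23 A) := by
  ext ⟨x, y, m⟩ ⟨u, v, m'⟩
  simp [rev3, twistHom_apply, leg12, leg23, leg21_apply]

lemma leg23_leg21 (A : Op2 K n) : leg23 (leg21 A) = rev3 K n (leg12 A) := by
  ext ⟨x, y, m⟩ ⟨u, v, m'⟩
  simp [rev3, twistHom_apply, leg12, leg23, leg21_apply]

/-- Exchange of the two tensor factors. -/
def swap2 (K : Type*) [Field K] (n : ℕ) : Op2 K n →ₐ[K] Op2 K n :=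
  twistHom (Equiv.prodComm _ _) (fun _ => 1) fun _ => one_ne_zero

lemma swap2_apply (A : Op2 K n) : swap2 K n A = leg21 A := by
  ext ⟨x, y⟩ ⟨u, v⟩
  simp [swap2, twistHom_apply, leg21_apply]

section
variable {a b : K}

lemma basicR_bmw (hn : 2 ≤ n) (ha : a ≠ 0) (hb : b ≠ 0) :
    BMWRelations (a⁻¹ * b) ((a⁻¹ * b) ^ (1 - 2 * (n : ℤ))) (loopValue n (a⁻¹ * b))
      (leg12 (basicR n a b)) (leg23 (basicR n a b))
      (leg12 (cupCap n (a⁻¹ * b))) (leg23 (cupCap n (a⁻¹ * b))) := by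
  obtain ⟨t, ht⟩ : ∃ t : Fin (2 * n), rho t = (n : ℤ) - 1 :=
    exists_rho_eq le_rfl (by omega)
  have hq : a⁻¹ * b ≠ 0 := mul_ne_zero (inv_ne_zero ha) hb
  have hc := mul_ne_zero ha hb
  have H := (stdR_bmw hn ht hq).map (twist3 (a * b) hc)
  rwa [← (stdR_preservesWeight _).leg12_twist2, ← (stdR_preservesWeight _).leg23_twist2,
    ← (cupCap_preservesWeight _).leg12_twist2, ← (cupCap_preservesWeight _).leg23_twist2,
    twist2_stdR ha hb, twist2_cupCap] at H

lemma leg21_basicR_bmw (hn : 2 ≤ n) (ha : a ≠ 0) (hb : b ≠ 0) :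
    BMWRelations (a⁻¹ * b) ((a⁻¹ * b) ^ (1 - 2 * (n : ℤ))) (loopValue n (a⁻¹ * b))
      (leg12 (leg21 (basicR n a b))) (leg23 (leg21 (basicR n a b)))
      (leg12 (leg21 (cupCap n (a⁻¹ * b)))) (leg23 (leg21 (cupCap n (a⁻¹ * b)))) := by
  simpa only [← leg12_leg21, ← leg23_leg21] using (basicR_bmw hn ha hb).symm.map (rev3 K n)

end

end

/-! ### The matrix `R(z)` as a Yang–Baxterization -/

section

variable {K : Type*} [Field K] {n : ℕ}

/-- The relations between one braid generator `g` with eigenvalues `q`, `-q⁻¹`, `l` and its tangle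
generator `e`. -/
structure SkeinRelations (q l δ : K) {A : Type*} [Ring A] [Algebra K A] (g e : A) : Prop where
  sq : g * g = 1 + (q - q⁻¹) • g - ((q - q⁻¹) * l) • e
  ge : g * e = l • e
  eg : e * g = l • e
  ee : e * e = δ • e
  delta : (q - q⁻¹) * l * δ = 1 + (q - q⁻¹) * l - l ^ 2

lemma SkeinRelations.map {A B : Type*} [Ring A] [Algebra K A] [Ring B] [Algebra K B] {q l δ : K}
    {g e : A} (H : SkeinRelations q l δ g e) (f : A →ₐ[K] B) :
    SkeinRelations q l δ (f g) (f e) := by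
  refine ⟨?_, ?_, ?_, ?_, H.delta⟩ <;>
    simp only [← map_mul, ← map_smul, ← map_one f, ← map_add, ← map_sub]
  exacts [congrArg f H.sq, congrArg f H.ge, congrArg f H.eg, congrArg f H.ee]

section
variable {a b : K}

lemma basicR_skein (hn : 2 ≤ n) (ha : a ≠ 0) (hb : b ≠ 0) :
    SkeinRelations (a⁻¹ * b) ((a⁻¹ * b) ^ (1 - 2 * (n : ℤ))) (loopValue n (a⁻¹ * b))
      (basicR n a b) (cupCap n (a⁻¹ * b)) := by
  obtain ⟨t, ht⟩ : ∃ t : Fin (2 * n), rho t = (n : ℤ) - 1 :=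
    exists_rho_eq le_rfl (by omega)
  have hq : a⁻¹ * b ≠ 0 := mul_ne_zero (inv_ne_zero ha) hb
  have H : SkeinRelations (a⁻¹ * b) ((a⁻¹ * b) ^ (1 - 2 * (n : ℤ))) (loopValue n (a⁻¹ * b))
      (stdR n (a⁻¹ * b)) (cupCap n (a⁻¹ * b)) :=
    ⟨stdR_mul_stdR hn ht hq, stdR_mul_cupCap hn ht hq, cupCap_mul_stdR hn ht hq,
      cupCap_mul_cupCap hq, loopValue_eq hn ht hq⟩
  simpa only [twist2_stdR ha hb, twist2_cupCap] using H.map (twist2 (a * b) (mul_ne_zero ha hb))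

lemma leg21_basicR_skein (hn : 2 ≤ n) (ha : a ≠ 0) (hb : b ≠ 0) :
    SkeinRelations (a⁻¹ * b) ((a⁻¹ * b) ^ (1 - 2 * (n : ℤ))) (loopValue n (a⁻¹ * b))
      (leg21 (basicR n a b)) (leg21 (cupCap n (a⁻¹ * b))) := by
  simpa only [swap2_apply] using (basicR_skein hn ha hb).map (swap2 K n)

/-- `baxter` is the three-eigenvalue Yang–Baxterization: `g⁻¹ = g - (q - q⁻¹) + (q - q⁻¹) e`. -/
lemma SkeinRelations.yangBaxterize_eq {q l δ : K} {g e : Op2 K n} (H : SkeinRelations q l δ g e)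
    (hq : q ≠ 0) (z : K) :
    yangBaxterize g q (-q⁻¹) l z = BMWRelations.baxter q l z g e := by
  rw [yangBaxterize, Matrix.inv_eq_right_inv (mul_inverse_of_skein H.sq H.ge), BMWRelations.baxter]
  match_scalars
  all_goals field_simp
  all_goals ring1

end

/-- The entries of `spectralR`. -/
lemma spectralR_apply (a b z : K) (x y u v : Fin (2 * n)) :
    spectralR n a b z (x, y) (u, v) =
      (if u = x ∧ y = x ∧ v = x then 1 else 0)
      + (if u = y ∧ v = x then a ^ 2 * b ^ 2 * (z - 1) / (a ^ 2 * z - b ^ 2) * braceCount K x y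
          + (z - 1) / (a ^ 2 * z - b ^ 2) * braceCount K y x else 0)
      + (if (x = u ∧ y = v) ∧ y ≠ op x then (a ^ 2 - b ^ 2) / (a ^ 2 * z - b ^ 2) *
          ((if y < x then z else 0) + if x < y then 1 else 0) else 0)
      + (if y = op x ∧ v = op u then
          1 / ((z - (a ^ 2) ^ (1 - (n : ℤ)) * (b ^ 2) ^ ((n : ℤ) - 1)) * (a ^ 2 * z - b ^ 2)) *
            dCoeff n a b z x v else 0) := by
  have s1 : (∑ i, EE K i i i i) (x, y) (u, v) = if u = x ∧ y = x ∧ v = x then 1 else 0 := by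
    rw [Matrix.sum_apply, Finset.sum_eq_single x]
    · simp [EE_apply, eq_comm]
    · intro i _ hi; simp [EE_apply, hi]
    · simp
  have s2 : (∑ i, ∑ j, if i < j ∧ op i ≠ j then EE K j j i i else 0) (x, y) (u, v) =
      if (x = u ∧ y = v) ∧ y ≠ op x then (if y < x then 1 else 0) else 0 := by
    simp only [Matrix.sum_apply]
    rw [Finset.sum_eq_single y, Finset.sum_eq_single x]
    · have e : op y = x ↔ y = op x := by rw [eq_comm]; exact eq_op_comm
      by_cases h : y < x ∧ y ≠ op x
      · rw [if_pos ⟨h.1, fun h' => h.2 (e.1 h')⟩, EE_apply]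
        simp [h]
      · rw [if_neg fun h' => h ⟨h'.1, fun h'' => h'.2 (e.2 h'')⟩, Matrix.zero_apply]
        split_ifs with h1 h2
        · exact absurd ⟨h2, h1.2⟩ h
        · rfl
        · rfl
    · intro j _ hj
      split_ifs <;> simp [EE_apply, hj]
    · simp
    · intro i _ hi
      refine Finset.sum_eq_zero fun j _ => ?_
      split_ifs <;> simp [EE_apply, hi]
    · simp
  have s3 : (∑ i, ∑ j, if i > j ∧ i ≠ op j then EE K j j i i else 0) (x, y) (u, v) =
      if (x = u ∧ y = v) ∧ y ≠ op x then (if x < y then 1 else 0) else 0 := by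
    simp only [Matrix.sum_apply]
    rw [Finset.sum_eq_single y, Finset.sum_eq_single x]
    · by_cases h : x < y ∧ y ≠ op x
      · rw [if_pos h, EE_apply]
        simp [h]
      · rw [if_neg h, Matrix.zero_apply]
        split_ifs with h1 h2
        · exact absurd ⟨h2, h1.2⟩ h
        · rfl
        · rfl
    · intro j _ hj
      split_ifs <;> simp [EE_apply, hj]
    · simp
    · intro i _ hi
      refine Finset.sum_eq_zero fun j _ => ?_
      split_ifs <;> simp [EE_apply, hi]
    · simp
  have s4 : (∑ i, ∑ j, dCoeff n a b z i j • EE K i (op j) (op i) j)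
      (x, y) (u, v) = if y = op x ∧ v = op u then dCoeff n a b z x v else 0 := by
    simp only [Matrix.sum_apply]
    rw [Finset.sum_eq_single x, Finset.sum_eq_single v]
    · have e : op x = y ↔ y = op x := eq_comm
      have e' : op v = u ↔ v = op u := by rw [eq_comm]; exact eq_op_comm
      rw [Matrix.smul_apply, EE_apply, smul_eq_mul, mul_ite, mul_one, mul_zero]
      refine if_congr ?_ rfl rfl
      simp only [e, e', true_and, and_true]; tauto
    · intro j _ hj; simp [EE_apply, hj]
    · simp
    · intro i _ hi
      refine Finset.sum_eq_zero fun j _ => ?_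
      simp [EE_apply, hi]
    · simp
  simp only [spectralR, Matrix.add_apply, Matrix.smul_apply, s1, s2, s3, s4,
    braceSum_apply, braceSum_swap_apply, smul_eq_mul]
  congr 1
  · congr 1
    · by_cases h : u = y ∧ v = x
      · simp only [if_pos h]; ring
      · simp only [if_neg h]; ring
    · by_cases h : (x = u ∧ y = v) ∧ y ≠ op x
      · simp only [if_pos h, mul_ite, mul_one, mul_zero]
      · simp only [if_neg h]; ring
  · rw [mul_ite, mul_zero]

section
variable {a q : K}

/-- The second pole `r^{1-n} s^{n-1}` of `R(z)` depends on `q` only. -/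
lemma pole_eq (ha : a ≠ 0) :
    (a ^ 2) ^ (1 - (n : ℤ)) * ((a * q) ^ 2) ^ ((n : ℤ) - 1) = q ^ (2 * (n : ℤ) - 2) := by
  rw [← neg_sub (n : ℤ) 1, zpow_neg, mul_pow, mul_zpow, inv_mul_cancel_left₀
    (zpow_ne_zero _ (pow_ne_zero _ ha)), ← zpow_natCast, ← zpow_mul]
  congr 1; push_cast; ring

lemma ratio_zpow (ha : a ≠ 0) (hq : q ≠ 0) (m : ℤ) :
    (a ^ 2 * ((a * q) ^ 2)⁻¹) ^ m = q ^ (-2 * m) := by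
  have : a ^ 2 * ((a * q) ^ 2)⁻¹ = q ^ (-2 : ℤ) := by
    rw [zpow_neg]; field_simp
  rw [this, ← zpow_mul]

lemma dCoeff_eq (ha : a ≠ 0) (hq : q ≠ 0) (z : K) (x v : Fin (2 * n)) :
    dCoeff n a (a * q) z x v =
      if v < x then a ^ 2 * (q ^ 2 - 1) * z * (q ^ (rho v - rho x) * (z - 1)
          - (if x = op v then 1 else 0) * (z - q ^ (2 * (n : ℤ) - 2)))
      else if x < v then a ^ 2 * (q ^ 2 - 1) *
          (q ^ (rho v - rho x) * q ^ (2 * (n : ℤ) - 2) * (z - 1)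
          - (if x = op v then 1 else 0) * (z - q ^ (2 * (n : ℤ) - 2)))
      else a ^ 2 * (q ^ 2 * z - q ^ (2 * (n : ℤ) - 2)) * (z - 1) := by
  have h1 : a⁻¹ * (a * q) = q := inv_mul_cancel_left₀ ha q
  have h2 : (-2 : ℤ) * (1 - (n : ℤ)) = 2 * n - 2 := by ring
  have h3 : q ^ ((-2 : ℤ) * (2 - (n : ℤ))) = q ^ (2 * (n : ℤ) - 2) * (q ^ 2)⁻¹ := by
    rw [← zpow_natCast, ← zpow_neg, ← zpow_add₀ hq]; congr 1; push_cast; ring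
  have h4 : rho v - rho x + 2 * (n : ℤ) - 2 = (rho v - rho x) + (2 * n - 2) := by ring
  simp only [dCoeff, ratio_zpow ha hq, h1, h2, h3, h4, zpow_add₀ hq, gt_iff_lt]
  split_ifs
  · ring
  · ring
  · ring
  · ring
  · field_simp

/-- `R(z)` is a multiple of the Yang–Baxterization of `leg21 basicR`. `cupCap` contributes only to
the block of the vectors `v_i ⊗ v_{i'}`, whose entries are given by the numbers `d_{ij}(z)`. -/
lemma spectralR_eq_baxter (ha : a ≠ 0) (hq : q ≠ 0) {z : K}
    (hz : NotPole n a (a * q) z) :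
    spectralR n a (a * q) z =
      (a ^ 2 / ((z - q ^ (2 * (n : ℤ) - 2)) * (a ^ 2 * z - (a * q) ^ 2))) •
        BMWRelations.baxter q (q ^ (1 - 2 * (n : ℤ))) z (leg21 (basicR n a (a * q)))
          (leg21 (cupCap n q)) := by
  obtain ⟨hz1, hz2⟩ := hz
  rw [pole_eq ha] at hz2
  have hl : (q ^ (1 - 2 * (n : ℤ)))⁻¹ = q * q ^ (2 * (n : ℤ) - 2) := by
    rw [← zpow_neg, ← zpow_one_add₀ hq]; congr 1; ring
  have hqq : a⁻¹ * (a * q) = q := inv_mul_cancel_left₀ ha q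
  have hqq' : a * (a * q)⁻¹ = q⁻¹ := by field_simp
  ext ⟨x, y⟩ ⟨u, v⟩
  simp only [BMWRelations.baxter, Matrix.smul_apply, Matrix.add_apply, Matrix.sub_apply,
    leg21_apply, hl, spectralR_apply, basicR_apply, pole_eq ha, smul_eq_mul, dCoeff_eq ha hq,
    hqq, hqq', Matrix.one_apply, Prod.mk.injEq, cupCap, Matrix.of_apply]
  generalize hQ : q ^ (2 * (n : ℤ) - 2) = Q at hz2 ⊢
  by_cases hyx : y = op x
  · subst hyx
    by_cases hvu : u = op v
    · subst hvu
      have e1 : op x = v ↔ x = op v := by rw [eq_comm]; exact eq_op_comm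
      have e2 : op v < op x ↔ x < v := Fin.rev_lt_rev
      have e4 : op v = x ↔ x = op v := eq_comm
      have e5 : op v = op x ↔ x = v := by rw [eq_comm]; exact Fin.rev_inj
      have e6 : v = x ↔ x = v := eq_comm
      have e7 : v = op x ↔ x = op v := eq_op_comm
      have e8 : rho (op x) + rho v = rho v - rho x := by rw [rho_op]; ring
      simp only [op_op, e1, e2, e4, e5, e6, e7, e8, op_ne_self, (op_ne_self _).symm, false_and,
        and_false, and_self, if_false, if_true, braceCount_op, braceCount_op', mul_zero, add_zero,
        ite_self, zero_add, true_and, ne_eq, not_true]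
      generalize hp : q ^ (rho v - rho x) = p
      have hD : ∀ d X : K, d = a ^ 2 * X →
          1 / ((z - Q) * (a ^ 2 * z - (a * q) ^ 2)) * d =
            a ^ 2 / ((z - Q) * (a ^ 2 * z - (a * q) ^ 2)) * X := by
        rintro d X rfl; ring
      apply hD
      rcases lt_trichotomy v x with h | rfl | h
      · have h1 : ¬ x < v := h.not_gt
        have h2 : ¬ x = v := h.ne'
        by_cases h3 : x = op v
        · have h4 : ¬ x < op x := by rw [e1.2 h3]; exact h1
          simp only [if_pos h, if_neg h1, if_neg h2, if_pos h3, h4, and_false, if_false]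
          field_simp
          ring
        · simp only [if_pos h, if_neg h1, if_neg h2, h3, false_and, if_false]
          field_simp
          ring
      · obtain rfl : p = 1 := by rw [← hp, sub_self, zpow_zero]
        simp only [lt_irrefl, if_false, if_true, (op_ne_self _).symm, false_and]
        field_simp
        ring
      · have h1 : ¬ v < x := h.not_gt
        have h2 : ¬ x = v := h.ne
        by_cases h3 : x = op v
        · have h4 : x < op x := by rw [e1.2 h3]; exact h
          simp only [if_pos h, if_neg h1, if_neg h2, if_pos h3,
            if_pos (And.intro h3 (And.intro h3 h4))]
          field_simp
          ring
        · simp only [if_pos h, if_neg h1, if_neg h2, h3, false_and, if_false]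
          field_simp
          ring
    · have hvu' : ¬ v = op u := fun h => hvu (eq_op_comm.1 h)
      have h1 : ¬ (u = op x ∧ v = x) := by
        rintro ⟨rfl, rfl⟩; exact hvu rfl
      have h2 : ¬ (x = u ∧ op x = v) := by
        rintro ⟨rfl, rfl⟩; exact hvu (op_op _).symm
      have h3 : ¬ (v = x ∧ u = op x) := fun h => h1 h.symm
      have h4 : ¬ (op x = v ∧ x = u ∧ x < op x) := fun h => h2 ⟨h.2.1, h.1⟩
      have h5 : ¬ (v = op (op x) ∧ u = op x) := by rw [op_op]; exact h3
      simp only [hvu, hvu', h1, h2, h3, h4, h5, op_ne_self, (op_ne_self _).symm, false_and,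
        and_false, if_false, mul_zero, add_zero, sub_zero]
  · have hx : ¬ x = op y := fun h => hyx (eq_op_comm.1 h)
    simp only [hyx, hx, false_and, if_false, add_zero, sub_zero, mul_zero, ne_eq, not_false_iff,
      and_true]
    have haq : a ^ 2 * z - (a * q) ^ 2 = a ^ 2 * (z - q ^ 2) := by ring
    rw [haq] at hz1 ⊢
    have hz3 : z - q ^ 2 ≠ 0 := right_ne_zero_of_mul hz1
    by_cases hsw : u = y ∧ v = x
    · obtain ⟨rfl, rfl⟩ := hsw
      by_cases h : u = v
      · subst h
        simp only [and_self, if_true, lt_irrefl, and_false, if_false, braceCount_self]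
        field_simp
        ring
      · have h' : ¬ v = u := fun h'' => h h''.symm
        simp only [h, h', and_self, false_and, if_true, if_false]
        field_simp
        ring
    · have h1 : ¬ (v = x ∧ u = y) := fun h => hsw h.symm
      have h2 : ¬ (u = x ∧ y = x ∧ v = x) := by
        rintro ⟨rfl, rfl, rfl⟩; exact hsw ⟨rfl, rfl⟩
      have h3 : ¬ (v = y ∧ x = y ∧ u = y) := by
        rintro ⟨rfl, rfl, rfl⟩; exact hsw ⟨rfl, rfl⟩
      simp only [if_neg hsw, if_neg h1, if_neg h2, if_neg h3]
      by_cases hd : x = u ∧ y = v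
      · obtain ⟨rfl, rfl⟩ := hd
        have hxy : x ≠ y := by rintro rfl; exact hsw ⟨rfl, rfl⟩
        rcases lt_or_gt_of_ne hxy with h | h
        · have h' : ¬ y < x := h.not_gt
          simp only [h, h', and_self, if_true, if_false]
          field_simp
          ring
        · have h' : ¬ x < y := not_lt_of_gt h
          simp only [show y < x from h, h', and_self, and_false, if_true, if_false]
          field_simp
          ring
      · have hd' : ¬ (y = v ∧ x = u ∧ x < y) := fun h => hd ⟨h.2.1, h.1⟩
        simp only [if_neg hd, if_neg hd']
        ring

end

end

/-! ### The flip, the quantum Yang–Baxter equation and unitarity -/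

section

variable {K : Type*} [Field K] {n : ℕ}

lemma flip_mul_EE (i j k l : Fin (2 * n)) : flip K n * EE K i j k l = EE K k j i l := by
  ext ⟨x, y⟩ ⟨u, v⟩
  rw [flip_mul_apply, EE_apply, EE_apply]
  exact if_congr (by tauto) rfl rfl

lemma flip_mul_sumOver (c : ℕ → ℕ → Prop) [∀ i j, Decidable (c i j)]
    (f : Fin (2 * n) → Fin (2 * n) → Op2 K n) :
    flip K n * sumOver c f = sumOver c fun i j => flip K n * f i j := by
  simp only [sumOver, Finset.mul_sum, mul_ite, mul_zero]

lemma flip_mul_braceSum (f : Fin (2 * n) → Fin (2 * n) → Op2 K n) :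
    flip K n * braceSum f = braceSum fun i j => flip K n * f i j := by
  simp only [braceSum, mul_add, flip_mul_sumOver]

lemma spectralRHat_eq_explicit (a b z : K) : spectralRHat n a b z = explicitRHat n a b z := by
  simp only [spectralRHat, spectralR, explicitRHat, mul_add, mul_smul_comm, flip_mul_braceSum,
    Finset.mul_sum, mul_ite, mul_zero, flip_mul_EE, cCoeff, Finset.smul_sum, smul_smul]
  congr 1
  refine Finset.sum_congr rfl fun i _ => Finset.sum_congr rfl fun j _ => ?_
  congr 1
  ring

lemma leg12_mul (A B : Op2 K n) : leg12 (A * B) = leg12 A * leg12 B := map_mul (leg12Hom K n) A B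

lemma leg23_mul (A B : Op2 K n) : leg23 (A * B) = leg23 A * leg23 B := map_mul (leg23Hom K n) A B

lemma leg12_flip_mul_self : leg12 (flip K n) * leg12 (flip K n) = 1 := by
  rw [← leg12_mul, flip_mul_flip]; exact map_one (leg12Hom K n)

lemma leg23_flip_mul_self : leg23 (flip K n) * leg23 (flip K n) = 1 := by
  rw [← leg23_mul, flip_mul_flip]; exact map_one (leg23Hom K n)

lemma leg12_flip_mul_apply (A : Op3 K n) (x y m : Fin (2 * n)) (w) :
    (leg12 (flip K n) * A) (x, y, m) w = A (y, x, m) w := by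
  rw [Matrix.mul_apply, Finset.sum_eq_single (y, x, m)]
  · simp [leg12, flip_apply]
  · rintro ⟨u, v, m'⟩ _ h
    have : ¬ (m = m' ∧ u = y ∧ v = x) := by rintro ⟨rfl, rfl, rfl⟩; exact h rfl
    simp only [leg12, Matrix.of_apply, flip_apply, ← ite_and, this, if_false, zero_mul]
  · simp

lemma leg23_flip_mul_apply (A : Op3 K n) (m x y : Fin (2 * n)) (w) :
    (leg23 (flip K n) * A) (m, x, y) w = A (m, y, x) w := by
  rw [Matrix.mul_apply, Finset.sum_eq_single (m, y, x)]
  · simp [leg23, flip_apply]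
  · rintro ⟨m', u, v⟩ _ h
    have : ¬ (m = m' ∧ u = y ∧ v = x) := by rintro ⟨rfl, rfl, rfl⟩; exact h rfl
    simp only [leg23, Matrix.of_apply, flip_apply, ← ite_and, this, if_false, zero_mul]
  · simp

lemma mul_leg12_flip_apply (A : Op3 K n) (w) (x y m : Fin (2 * n)) :
    (A * leg12 (flip K n)) w (x, y, m) = A w (y, x, m) := by
  rw [Matrix.mul_apply, Finset.sum_eq_single (y, x, m)]
  · simp [leg12, flip_apply]
  · rintro ⟨u, v, m'⟩ _ h
    have : ¬ (m' = m ∧ x = v ∧ y = u) := by rintro ⟨rfl, rfl, rfl⟩; exact h rfl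
    simp only [leg12, Matrix.of_apply, flip_apply, ← ite_and, this, if_false, mul_zero]
  · simp

lemma mul_leg23_flip_apply (A : Op3 K n) (w) (m x y : Fin (2 * n)) :
    (A * leg23 (flip K n)) w (m, x, y) = A w (m, y, x) := by
  rw [Matrix.mul_apply, Finset.sum_eq_single (m, y, x)]
  · simp [leg23, flip_apply]
  · rintro ⟨m', u, v⟩ _ h
    have : ¬ (m' = m ∧ x = v ∧ y = u) := by rintro ⟨rfl, rfl, rfl⟩; exact h rfl
    simp only [leg23, Matrix.of_apply, flip_apply, ← ite_and, this, if_false, mul_zero]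
  · simp

lemma leg13_eq_leg12 (A : Op2 K n) :
    leg13 A = leg23 (flip K n) * leg12 A * leg23 (flip K n) := by
  ext ⟨x, y, m⟩ ⟨u, v, m'⟩
  rw [mul_leg23_flip_apply, leg23_flip_mul_apply]
  rfl

lemma leg13_eq_leg23 (A : Op2 K n) :
    leg13 A = leg12 (flip K n) * leg23 A * leg12 (flip K n) := by
  ext ⟨x, y, m⟩ ⟨u, v, m'⟩
  rw [mul_leg12_flip_apply, leg12_flip_mul_apply]
  rfl

lemma flip_braid :
    leg12 (flip K n) * leg23 (flip K n) * leg12 (flip K n) =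
      leg23 (flip K n) * leg12 (flip K n) * leg23 (flip K n) :=
  (leg13_eq_leg23 _).symm.trans (leg13_eq_leg12 _)

/-- The permutation of the tensor factors by two adjacent flips carries `A₂₃` to `A₁₂`. -/
lemma leg12_mul_flips (A : Op2 K n) :
    leg12 A * (leg23 (flip K n) * leg12 (flip K n)) =
      leg23 (flip K n) * leg12 (flip K n) * leg23 A := by
  have h : leg23 (flip K n) * (leg23 (flip K n) * leg12 A * leg23 (flip K n)) * leg12 (flip K n) =
      leg23 (flip K n) * (leg12 (flip K n) * leg23 A * leg12 (flip K n)) * leg12 (flip K n) := by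
    rw [← leg13_eq_leg12, ← leg13_eq_leg23]
  simp only [← mul_assoc, leg23_flip_mul_self, one_mul] at h
  rw [mul_assoc _ (leg12 (flip K n)) (leg12 (flip K n)), leg12_flip_mul_self, mul_one] at h
  rw [← mul_assoc, h]

lemma leg23_mul_flips (A : Op2 K n) :
    leg23 A * (leg12 (flip K n) * leg23 (flip K n)) =
      leg12 (flip K n) * leg23 (flip K n) * leg12 A := by
  have h : leg12 (flip K n) * (leg12 (flip K n) * leg23 A * leg12 (flip K n)) * leg23 (flip K n) =
      leg12 (flip K n) * (leg23 (flip K n) * leg12 A * leg23 (flip K n)) * leg23 (flip K n) := by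
    rw [← leg13_eq_leg12, ← leg13_eq_leg23]
  simp only [← mul_assoc, leg12_flip_mul_self, one_mul] at h
  rw [mul_assoc _ (leg23 (flip K n)) (leg23 (flip K n)), leg23_flip_mul_self, mul_one] at h
  rw [← mul_assoc, h]

/-- The two forms of the Yang–Baxter equation: a braided solution composed with the flip solves the
quantum Yang–Baxter equation. -/
lemma quantum_yang_baxter_of_braided {A B C : Op2 K n}
    (h : leg23 A * leg12 B * leg23 C = leg12 C * leg23 B * leg12 A) :
    leg12 (flip K n * A) * leg13 (flip K n * B) * leg23 (flip K n * C) =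
      leg23 (flip K n * C) * leg13 (flip K n * B) * leg12 (flip K n * A) := by
  have e1 : leg12 (flip K n * A) * leg13 (flip K n * B) * leg23 (flip K n * C) =
      leg12 (flip K n) * leg23 (flip K n) * leg12 (flip K n) *
        (leg23 A * leg12 B * leg23 C) := by
    rw [leg13_eq_leg12, leg12_mul, leg12_mul, leg23_mul]
    calc _ = leg12 (flip K n) * (leg12 A * (leg23 (flip K n) * leg12 (flip K n))) * leg12 B *
          (leg23 (flip K n) * leg23 (flip K n)) * leg23 C := by simp only [mul_assoc]
      _ = _ := by rw [leg12_mul_flips, leg23_flip_mul_self, mul_one]; simp only [mul_assoc]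
  have e2 : leg23 (flip K n * C) * leg13 (flip K n * B) * leg12 (flip K n * A) =
      leg23 (flip K n) * leg12 (flip K n) * leg23 (flip K n) *
        (leg12 C * leg23 B * leg12 A) := by
    rw [leg13_eq_leg23, leg12_mul, leg23_mul, leg23_mul]
    calc _ = leg23 (flip K n) * (leg23 C * (leg12 (flip K n) * leg23 (flip K n))) * leg23 B *
          (leg12 (flip K n) * leg12 (flip K n)) * leg12 A := by simp only [mul_assoc]
      _ = _ := by rw [leg23_mul_flips, leg12_flip_mul_self, mul_one]; simp only [mul_assoc]
  rw [e1, e2, h, flip_braid]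

lemma BMWRelations.map_baxter {A B : Type*} [Ring A] [Algebra K A] [Ring B] [Algebra K B]
    (f : A →ₐ[K] B) (q l z : K) (g e : A) :
    f (baxter q l z g e) = baxter q l z (f g) (f e) := by
  simp only [baxter, map_add, map_sub, map_smul, map_one]

section
variable {a q : K}

/-- The braided Yang–Baxter equation for `R(z)`. -/
lemma spectralR_braided (hn : 2 ≤ n) (ha : a ≠ 0) (hq : q ≠ 0) {z w : K}
    (hz : NotPole n a (a * q) z) (hw : NotPole n a (a * q) w)
    (hzw : NotPole n a (a * q) (z * w)) :
    leg23 (spectralR n a (a * q) z) * leg12 (spectralR n a (a * q) (z * w)) *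
        leg23 (spectralR n a (a * q) w) =
      leg12 (spectralR n a (a * q) w) * leg23 (spectralR n a (a * q) (z * w)) *
        leg12 (spectralR n a (a * q) z) := by
  have H := (leg21_basicR_bmw (n := n) hn ha (mul_ne_zero ha hq)).symm
  have hl : q ^ (1 - 2 * (n : ℤ)) ≠ 0 := zpow_ne_zero _ hq
  obtain ⟨t, ht⟩ : ∃ t : Fin (2 * n), rho t = (n : ℤ) - 1 := exists_rho_eq le_rfl (by omega)
  rw [inv_mul_cancel_left₀ ha q] at H
  have Y := H.yang_baxter hq hl (loopValue_eq hn ht hq) z w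
  simp only [spectralR_eq_baxter ha hq hz, spectralR_eq_baxter ha hq hw,
    spectralR_eq_baxter ha hq hzw, ← leg12Hom_apply, ← leg23Hom_apply, map_smul,
    BMWRelations.map_baxter, smul_mul_assoc, mul_smul_comm]
  simp only [leg12Hom_apply, leg23Hom_apply, Y]
  simp only [smul_smul]
  congr 1
  ring

/-- Unitarity of `R(z)`: the normalizing scalars cancel the factors in `baxter_mul_baxter_inv`. -/
lemma spectralR_mul_inv (hn : 2 ≤ n) (ha : a ≠ 0) (hq : q ≠ 0) {z : K} (h0 : z ≠ 0)
    (hz : NotPole n a (a * q) z) (hz' : NotPole n a (a * q) z⁻¹) :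
    spectralR n a (a * q) z * spectralR n a (a * q) z⁻¹ = 1 := by
  have H := leg21_basicR_skein (n := n) hn ha (mul_ne_zero ha hq)
  have hl : q ^ (1 - 2 * (n : ℤ)) ≠ 0 := zpow_ne_zero _ hq
  rw [inv_mul_cancel_left₀ ha q] at H
  rw [spectralR_eq_baxter ha hq hz, spectralR_eq_baxter ha hq hz', smul_mul_assoc,
    mul_smul_comm, baxter_mul_baxter_inv hq hl H.sq H.ge H.eg H.ee H.delta h0, smul_smul,
    smul_smul]
  have hl' : (q ^ (1 - 2 * (n : ℤ)))⁻¹ = q * q ^ (2 * (n : ℤ) - 2) := by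
    rw [← zpow_neg, ← zpow_one_add₀ hq]; congr 1; ring
  have key : ∀ y, NotPole n a (a * q) y →
      a ^ 2 / ((y - q ^ (2 * (n : ℤ) - 2)) * (a ^ 2 * y - (a * q) ^ 2)) *
        ((q * y - (q ^ (1 - 2 * (n : ℤ)))⁻¹) * (y - q ^ 2) * q⁻¹) = 1 := by
    rintro y ⟨h1, h2⟩
    rw [pole_eq ha] at h2
    rw [hl']
    generalize q ^ (2 * (n : ℤ) - 2) = Q at h2 ⊢
    have e : a ^ 2 * y - (a * q) ^ 2 = a ^ 2 * (y - q ^ 2) := by ring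
    rw [e] at h1 ⊢
    have h3 : y - q ^ 2 ≠ 0 := right_ne_zero_of_mul h1
    field_simp
  have k1 := key z hz
  have k2 := key z⁻¹ hz'
  rw [mul_mul_mul_comm, k1, k2, mul_one, one_smul]

lemma notPole_zero (ha : a ≠ 0) (hq : q ≠ 0) : NotPole n a (a * q) 0 := by
  constructor
  · simp [ha, hq]
  · rw [pole_eq ha, zero_sub]; exact neg_ne_zero.2 (zpow_ne_zero _ hq)

lemma spectralR_zero (ha : a ≠ 0) (hq : q ≠ 0) :
    spectralR n a (a * q) 0 = (a * (a * q)⁻¹) • leg21 (basicR n a (a * q)) := by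
  rw [spectralR_eq_baxter ha hq (notPole_zero ha hq), BMWRelations.baxter]
  have hl' : (q ^ (1 - 2 * (n : ℤ)))⁻¹ = q * q ^ (2 * (n : ℤ) - 2) := by
    rw [← zpow_neg, ← zpow_one_add₀ hq]; congr 1; ring
  have hQ : q ^ (2 * (n : ℤ) - 2) ≠ 0 := zpow_ne_zero _ hq
  rw [hl']
  generalize q ^ (2 * (n : ℤ) - 2) = Q at hQ ⊢
  match_scalars <;> field_simp <;> ring

end

end

end TwoParamD

theorem proposition4p4 {K : Type*} [Field K] (n : ℕ) (hn : 2 ≤ n)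
    (a b : K) (ha : a ≠ 0) (hb : b ≠ 0) (r s l1 l2 l3 : K)
    (hr : r = a ^ 2) (hs : s = b ^ 2)
    (hl1 : l1 = a⁻¹ * b) (hl2 : l2 = -(a * b⁻¹))
    (hl3 : l3 = a ^ (2 * (n : ℤ) - 1) * b ^ (-(2 * (n : ℤ) - 1))) :
    -- the basic `R`-matrix is an invertible braid matrix with eigenvalues `l1`, `l2`, `l3`
    (IsUnit (TwoParamD.basicR n a b) ∧
      (TwoParamD.basicR n a b - l1 • 1) * (TwoParamD.basicR n a b - l2 • 1)
        * (TwoParamD.basicR n a b - l3 • 1) = 0 ∧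
      TwoParamD.leg12 (TwoParamD.basicR n a b) * TwoParamD.leg23 (TwoParamD.basicR n a b)
          * TwoParamD.leg12 (TwoParamD.basicR n a b)
        = TwoParamD.leg23 (TwoParamD.basicR n a b) * TwoParamD.leg12 (TwoParamD.basicR n a b)
          * TwoParamD.leg23 (TwoParamD.basicR n a b)) ∧
    -- `R(z)` is the Yang-Baxterization of the basic `R`-matrix
    (∀ z : K, TwoParamD.NotPole n a b z →
      TwoParamD.spectralR n a b z
        = (r / ((z - r ^ (1 - (n : ℤ)) * s ^ ((n : ℤ) - 1)) * (r * z - s))) •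
            TwoParamD.yangBaxterize (TwoParamD.leg21 (TwoParamD.basicR n a b)) l1 l2 l3 z) ∧
    TwoParamD.spectralR n a b 0 = (a * b⁻¹) • TwoParamD.leg21 (TwoParamD.basicR n a b) ∧
    -- the explicit form of `R̂(z) = P ∘ R(z)`
    (∀ z : K, TwoParamD.spectralRHat n a b z = TwoParamD.explicitRHat n a b z) ∧
    -- the quantum Yang-Baxter equation
    (∀ z w : K, TwoParamD.NotPole n a b z → TwoParamD.NotPole n a b w →
      TwoParamD.NotPole n a b (z * w) →
      TwoParamD.leg12 (TwoParamD.spectralRHat n a b z)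
          * TwoParamD.leg13 (TwoParamD.spectralRHat n a b (z * w))
          * TwoParamD.leg23 (TwoParamD.spectralRHat n a b w)
        = TwoParamD.leg23 (TwoParamD.spectralRHat n a b w)
          * TwoParamD.leg13 (TwoParamD.spectralRHat n a b (z * w))
          * TwoParamD.leg12 (TwoParamD.spectralRHat n a b z)) ∧
    -- unitarity
    (∀ z : K, z ≠ 0 → TwoParamD.NotPole n a b z → TwoParamD.NotPole n a b z⁻¹ →
      TwoParamD.leg21 (TwoParamD.spectralRHat n a b z) * TwoParamD.spectralRHat n a b z⁻¹ = 1 ∧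
      TwoParamD.spectralRHat n a b z⁻¹ * TwoParamD.leg21 (TwoParamD.spectralRHat n a b z) = 1) := by
  -- With `q = a⁻¹ b` the parameters `l1`, `l2`, `l3` are `q`, `-q⁻¹` and `q ^ (1 - 2n)`.
  obtain ⟨q, rfl⟩ : ∃ q, b = a * q := ⟨a⁻¹ * b, (mul_inv_cancel_left₀ ha b).symm⟩
  have hq : q ≠ 0 := right_ne_zero_of_mul hb
  have hqq : a⁻¹ * (a * q) = q := inv_mul_cancel_left₀ ha q
  obtain rfl : l1 = q := hl1.trans hqq
  obtain rfl : l2 = -l1⁻¹ := by rw [hl2]; field_simp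
  obtain rfl : l3 = l1 ^ (1 - 2 * (n : ℤ)) := by
    rw [hl3, mul_zpow, zpow_neg a, mul_inv_cancel_left₀ (zpow_ne_zero _ ha), neg_sub]
  subst hr hs
  have B := TwoParamD.basicR_skein (n := n) hn ha hb
  have S := TwoParamD.leg21_basicR_skein (n := n) hn ha hb
  rw [hqq] at B S
  refine ⟨⟨?_, TwoParamD.cubic_of_skein hq B.sq B.eg, (TwoParamD.basicR_bmw hn ha hb).braid⟩,
    fun z hz => ?_, TwoParamD.spectralR_zero ha hq,
    TwoParamD.spectralRHat_eq_explicit a _, fun z w hz hw hzw =>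
      TwoParamD.quantum_yang_baxter_of_braided (TwoParamD.spectralR_braided hn ha hq hz hw hzw),
    fun z h0 hz hz' => ?_⟩
  · exact IsUnit.of_mul_eq_one _ (TwoParamD.mul_inverse_of_skein B.sq B.ge)
  · rw [S.yangBaxterize_eq hq, TwoParamD.pole_eq ha]
    exact TwoParamD.spectralR_eq_baxter ha hq hz
  · have h : TwoParamD.leg21 (TwoParamD.spectralRHat n a (a * l1) z) *
        TwoParamD.spectralRHat n a (a * l1) z⁻¹ = 1 := by
      rw [TwoParamD.leg21, TwoParamD.spectralRHat, TwoParamD.spectralRHat, ← mul_assoc,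
        ← mul_assoc, TwoParamD.flip_mul_flip, one_mul, mul_assoc (TwoParamD.spectralR _ _ _ _),
        TwoParamD.flip_mul_flip, mul_one]
      exact TwoParamD.spectralR_mul_inv hn ha hq h0 hz hz'
    exact ⟨h, mul_eq_one_comm.1 h⟩
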